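/- Let $(X,d)$ be a complete separable metric space and let $E:X\to\mathbb{R}\cup\{+\infty\}$ be lower semicontinuous, with dense domain $D(E)=\{E<\infty\}$, and bounded from below on every $d$-bounded set. Let $\lambda\in\mathbb{R}$ and assume that for every $x\in X$ there exists an $\mathrm{EVI}_\lambda$-gradient flow of $E$ starting at $x$, that is, a curve $u\in AC_{loc}((0,\infty),X)$ with $u_t\to x$ as $t\downarrow 0$ such that, for every $y\in X$ and for a.e. $t>0$, \[ \frac12\frac{d}{dt}d^2(u_t,y)+\frac{\lambda}{2}d^2(u_t,y)+E(u_t)\le E(y). \] Such a flow is unique; write $S_tx:=u_t$ for $t>0$ and $S_0x:=x$. Let $|\partial E|(x):=\limsup_{y\to x}\frac{[E(x)-E(y)]^+}{d(x,y)}$ for $x\in D(E)$ ($0$ if $x$ is isolated), and $|\partial E|(x):=+\infty$ for $x\notin D(E)$. For a curve $\gamma$ in $X$ denote by $|\dot\gamma_t|:=\lim_{s\to t}\frac{d(\gamma_s,\gamma_t)}{|s-t|}$ its metric speed. Let $\gamma:[0,1]\to X$ be an absolutely continuous curve, let $h:[0,1]\to\mathbb{R}$ be absolutely continuous with $h(t)>0$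 for all $t\in(0,1)$, and set $\tilde\gamma_t:=S_{h(t)}\gamma_t$ for $t\in[0,1]$. Then $E(\tilde\gamma_t)<\infty$ and $|\partial E|(\tilde\gamma_t)<\infty$ for all $t\in(0,1)$, and for a.e. $t\in(0,1)$ the metric speeds $|\dot\gamma_t|$ and $|\dot{\tilde\gamma}_t|$ and the derivatives $h'(t)$ and $\frac{d}{dt}E(\tilde\gamma_t)$ exist (and are finite) and satisfy \[ \frac12|\dot{\tilde\gamma}_t|^2+\frac12|h'(t)|^2\,|\partial E|^2(\tilde\gamma_t)+h'(t)\,\frac{d}{dt}E(\tilde\gamma_t)\le\frac12 e^{-2\lambda h(t)}|\dot\gamma_t|^2 . \] -/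

import Mathlib

open Set Filter Topology MeasureTheory

/-- `γ` has metric speed `v` at time `t`: `v = lim_{s → t} d(γ_s, γ_t) / |s - t|`. -/
def HasMetricSpeedAt {X : Type*} [MetricSpace X] (γ : ℝ → X) (v t : ℝ) : Prop :=
  Tendsto (fun s : ℝ => dist (γ s) (γ t) / |s - t|) (𝓝[≠] t) (𝓝 v)

open Classical in
/-- The (descending) metric slope `|∂E|(x) ∈ [0, ∞]`: it is `∞` where `E = +∞`, and
`limsup_{y → x, y ≠ x} [E(x) - E(y)]⁺ / d(x, y)` elsewhere. At an isolated point of the domain the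
limsup is along the trivial filter and equals `0`, see `descendingSlope_of_isolated`. -/
noncomputable def descendingSlope {X : Type*} [MetricSpace X] (E : X → EReal) (x : X) : ENNReal :=
  if E x = ⊤ then ⊤
  else limsup (fun y => (E x - E y).toENNReal / edist x y) (𝓝[≠] x)

theorem descendingSlope_of_isolated {X : Type*} [MetricSpace X] (E : X → EReal) (x : X)
    (hx : E x ≠ ⊤) (hiso : 𝓝[≠] x = ⊥) : descendingSlope E x = 0 := by
  simp [descendingSlope, hx, hiso]

/-- `u` (only its values at times `t > 0` matter) is a gradient flow of `E` in the `EVI_lam` sense: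
`u ∈ AC_loc((0, ∞), X)`, and for every `y`, for almost every `t > 0`,
`½ d/dt d²(u_t, y) + lam/2 d²(u_t, y) + E(u_t) ≤ E(y)`. -/
structure IsEVIFlow {X : Type*} [MetricSpace X] (E : X → EReal) (lam : ℝ) (u : ℝ → X) : Prop where
  ac_loc : ∀ a b : ℝ, 0 < a → a ≤ b → AbsolutelyContinuousOnInterval u a b
  evi : ∀ y : X, ∀ᵐ t : ℝ, 0 < t → ∃ D : ℝ, HasDerivAt (fun s => dist (u s) y ^ 2) D t ∧
    ((1 / 2 * D + lam / 2 * dist (u t) y ^ 2 : ℝ) : EReal) + E (u t) ≤ E y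

/-- `u` is an `EVI_lam` gradient flow of `E` that starts at `x ∈ closure D(E)`. -/
structure IsEVIFlowFrom {X : Type*} [MetricSpace X] (E : X → EReal) (lam : ℝ) (u : ℝ → X)
    (x : X) : Prop where
  flow : IsEVIFlow E lam u
  mem_closure : x ∈ closure {z | E z ≠ ⊤}
  tendsto_start : Tendsto u (𝓝[>] 0) (𝓝 x)

open Classical in
/-- `S_t x`: the value at time `t > 0` of the `EVI_lam` gradient flow of `E` starting at `x`, and
`S_0 x = x`. There is at most one such flow, so that the choice is immaterial; the value is `x`
where no flow starts, and for `t < 0`. -/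
noncomputable def eviSemigroup {X : Type*} [MetricSpace X] (E : X → EReal) (lam : ℝ)
    (t : ℝ) (x : X) : X :=
  if hx : ∃ u : ℝ → X, IsEVIFlowFrom E lam u x then
    if 0 < t then hx.choose t else x
  else x

/-- The standing assumptions on `E : X → ℝ ∪ {+∞}`: lower semicontinuous, with dense domain,
bounded from below on bounded sets, and every point is the start of an `EVI_lam` gradient flow. -/
structure EVISetting {X : Type*} [MetricSpace X] (E : X → EReal) (lam : ℝ) : Prop where
  ne_bot : ∀ x, E x ≠ ⊥
  lsc : LowerSemicontinuous E
  dense_domain : Dense {x | E x ≠ ⊤}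
  bddBelow : ∀ B : Set X, Bornology.IsBounded B → ∃ c : ℝ, ∀ x ∈ B, (c : EReal) ≤ E x
  exists_flow : ∀ x : X, ∃ u : ℝ → X, IsEVIFlowFrom E lam u x

/-! Write `u x` for the flow from `x` and `Γ t = u (γ t) (h t)`. Fix a good time `t` and let `s`
approach it from a side on which `h s > h t`. Integrate the EVI for the flow of `γ s` over `[h t, h
s]`, tested at the point `Γ t`. At the right end the flow is at `Γ s`; at the left end its distance
to `Γ t` is at most `exp (-λ h t) d(γ s, γ t)`, by contraction. The inequality therefore compares
`d(Γ s, Γ t)²` and `d(γ s, γ t)²` with a weighted integral of `E (Γ t) - E (u (γ s) r)`. Divided by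
`(s - t)²`, it gives the claim in the limit.

The slope enters through the second-order part of that integral. If `c < |∂E|(Γ t)`, some `z`
witnesses steepness `c` at every point near `Γ t`, by lower semicontinuity, and a flow through steep
points loses energy at rate at least `c²`. Otherwise the EVI would make its right speed at most `c`,
and a right speed at most `c` excludes such a `z`. Hence `E (u (γ s) r) ≥ E (Γ s) + c² (h s - r)`;
finally `c` increases to the slope. If `h' = 0`, contraction and Lipschitz continuity in time
suffice.

Differentiability almost everywhere comes from absolute continuity of `Γ` and `E ∘ Γ`. Contraction
applied to time shifts and summed dissipation make flows Lipschitz away from time `0`, uniformly for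
starting points in a bounded set. The Lipschitz constant also bounds the slope, which controls `E`
along `Γ`. -/

/-! ### Absolutely continuous curves and their metric speed. -/

theorem AbsolutelyContinuousOnInterval.of_dist_le {X Y Z : Type*} [PseudoMetricSpace X]
    [PseudoMetricSpace Y] [PseudoMetricSpace Z] {f : ℝ → X} {g : ℝ → Y} {k : ℝ → Z} {a b : ℝ}
    (K L : ℝ) (hg : AbsolutelyContinuousOnInterval g a b)
    (hk : AbsolutelyContinuousOnInterval k a b)
    (hf : ∀ s ∈ uIcc a b, ∀ t ∈ uIcc a b,
      dist (f s) (f t) ≤ K * dist (g s) (g t) + L * dist (k s) (k t)) :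
    AbsolutelyContinuousOnInterval f a b := by
  have hlim := (Tendsto.const_mul K hg).add (Tendsto.const_mul L hk)
  rw [mul_zero, mul_zero, add_zero] at hlim
  refine tendsto_of_tendsto_of_tendsto_of_le_of_le' tendsto_const_nhds hlim
    (Eventually.of_forall fun _ => Finset.sum_nonneg fun _ _ => dist_nonneg) ?_
  refine eventually_inf_principal.2 (Eventually.of_forall fun I hI => ?_)
  rw [Finset.mul_sum, Finset.mul_sum, ← Finset.sum_add_distrib]
  exact Finset.sum_le_sum fun i hi => hf _ (hI.1 i hi).1 _ (hI.1 i hi).2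

theorem AbsolutelyContinuousOnInterval.dist_comp {X : Type*} [PseudoMetricSpace X] {u v : ℝ → X}
    {a b : ℝ} (hu : AbsolutelyContinuousOnInterval u a b)
    (hv : AbsolutelyContinuousOnInterval v a b) :
    AbsolutelyContinuousOnInterval (fun t => dist (u t) (v t)) a b := by
  refine .of_dist_le 1 1 hu hv fun s _ t _ => ?_
  rw [one_mul, one_mul]
  exact dist_dist_dist_le _ _ _ _

theorem absolutelyContinuousOnInterval_const {X : Type*} [PseudoMetricSpace X] (x : X) (a b : ℝ) :
    AbsolutelyContinuousOnInterval (fun _ : ℝ => x) a b :=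
  (LipschitzWith.const x).lipschitzOnWith.absolutelyContinuousOnInterval

theorem AbsolutelyContinuousOnInterval.dist_const {X : Type*} [PseudoMetricSpace X] {u : ℝ → X}
    {a b : ℝ} (hu : AbsolutelyContinuousOnInterval u a b) (y : X) :
    AbsolutelyContinuousOnInterval (fun t => dist (u t) y) a b :=
  hu.dist_comp (absolutelyContinuousOnInterval_const y a b)

theorem AbsolutelyContinuousOnInterval.continuousOn_of_metric {X : Type*} [PseudoMetricSpace X]
    {u : ℝ → X} {a b : ℝ} (hu : AbsolutelyContinuousOnInterval u a b) :
    ContinuousOn u (uIcc a b) := by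
  intro t ht
  have h := (hu.dist_const (u t)).continuousOn t ht
  rw [ContinuousWithinAt, dist_self] at h
  exact tendsto_iff_dist_tendsto_zero.2 h

theorem AbsolutelyContinuousOnInterval.le_of_ae_deriv_nonpos {f : ℝ → ℝ} {a b : ℝ} (hab : a ≤ b)
    (hf : AbsolutelyContinuousOnInterval f a b)
    (hd : ∀ᵐ t : ℝ, t ∈ Ioo a b → ∃ D : ℝ, HasDerivAt f D t ∧ D ≤ 0) : f b ≤ f a := by
  have h1 : ∫ t in a..b, deriv f t ≤ 0 := by
    rw [intervalIntegral.integral_of_le hab, integral_Ioc_eq_integral_Ioo]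
    refine setIntegral_nonpos_of_ae_restrict ?_
    rw [EventuallyLE, ae_restrict_iff' measurableSet_Ioo]
    filter_upwards [hd] with t ht hmem
    obtain ⟨D, hD, hD0⟩ := ht hmem
    rw [hD.deriv]
    exact hD0
  rw [hf.integral_deriv_eq_sub] at h1
  linarith

theorem HasDerivAt.tendsto_abs_div {f : ℝ → ℝ} {D t : ℝ} (hf : HasDerivAt f D t) :
    Tendsto (fun s => |f s - f t| / |s - t|) (𝓝[≠] t) (𝓝 |D|) := by
  have := (hasDerivAt_iff_tendsto_slope.1 hf).abs
  refine this.congr fun s => ?_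
  rw [slope_def_field, abs_div]

/-- The speed is the supremum of `|f n'|`, where `f n` is the distance to the `n`-th point of a
dense sequence. Each `f n` bounds the difference quotients from below; the integral of the supremum
bounds them from above, and Lebesgue differentiation closes the gap. -/
theorem AbsolutelyContinuousOnInterval.ae_hasMetricSpeedAt {X : Type*} [MetricSpace X]
    [TopologicalSpace.SeparableSpace X] {γ : ℝ → X} {a b : ℝ} (hab : a ≤ b)
    (hγ : AbsolutelyContinuousOnInterval γ a b) :
    ∀ᵐ t : ℝ, t ∈ Ioo a b → ∃ v : ℝ, HasMetricSpeedAt γ v t := by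
  have : Nonempty X := ⟨γ 0⟩
  set y : ℕ → X := TopologicalSpace.denseSeq X with hy
  set f : ℕ → ℝ → ℝ := fun n t => dist (γ t) (y n) with hfdef
  have hf : ∀ n, AbsolutelyContinuousOnInterval (f n) a b := fun n => hγ.dist_const (y n)
  -- An isometric copy of the curve in a normed space. Its variation function `V` is monotone, so
  -- `V'` is integrable and can dominate every `|f n'|`.
  set φ : ℝ → lp (fun _ : ℕ => ℝ) ⊤ := fun t => kuratowskiEmbedding X (γ t) with hφ
  have hφdist : ∀ s t, dist (φ s) (φ t) = dist (γ s) (γ t) := fun s t =>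
    (kuratowskiEmbedding.isometry X).dist_eq _ _
  have hbv : LocallyBoundedVariationOn φ (Icc a b) := by
    have := (AbsolutelyContinuousOnInterval.of_dist_le (f := φ) 1 0 hγ hγ
      fun s _ t _ => by rw [hφdist]; linarith).boundedVariationOn
    rw [uIcc_of_le hab] at this
    exact this.locallyBoundedVariationOn
  set V : ℝ → ℝ := variationOnFromTo φ (Icc a b) a with hV
  have ha : a ∈ Icc a b := left_mem_Icc.2 hab
  have hVmono : MonotoneOn V (Icc a b) := variationOnFromTo.monotoneOn hbv ha
  have hVdist : ∀ s ∈ Icc a b, ∀ t ∈ Icc a b, dist (γ s) (γ t) ≤ |V s - V t| := by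
    intro s hs t ht
    wlog hst : s ≤ t generalizing s t
    · rw [dist_comm, abs_sub_comm]
      exact this t ht s hs (le_of_not_ge hst)
    rw [dist_comm, abs_sub_comm]
    have h1 : V t - V s = variationOnFromTo φ (Icc a b) s t := by
      have := variationOnFromTo.add hbv ha hs ht
      simp only [hV]
      linarith
    rw [h1]
    refine le_trans ?_ (le_abs_self _)
    rw [variationOnFromTo.eq_of_le _ _ hst, ← hφdist, dist_edist]
    have hfin : eVariationOn φ (Icc a b ∩ Icc s t) ≠ ⊤ := hbv s t hs ht
    refine ENNReal.toReal_mono hfin ?_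
    exact eVariationOn.edist_le _ ⟨ht, right_mem_Icc.2 hst⟩ ⟨hs, left_mem_Icc.2 hst⟩
  have hfdist : ∀ n s t, |f n s - f n t| ≤ dist (γ s) (γ t) := fun n s t =>
    abs_dist_sub_le _ _ _
  have hVdiff : ∀ᵐ t : ℝ, t ∈ Icc a b → DifferentiableWithinAt ℝ V (Icc a b) t :=
    hVmono.ae_differentiableWithinAt_of_mem
  have hfdiff : ∀ᵐ t : ℝ, ∀ n, t ∈ uIcc a b → DifferentiableAt ℝ (f n) t :=
    ae_all_iff.2 fun n => (hf n).ae_differentiableAt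
  set m : ℝ → ℝ := fun t => ⨆ n, |deriv (f n) t| with hm
  have hmbound : ∀ᵐ t : ℝ, t ∈ Ioo a b → ∀ n, |deriv (f n) t| ≤ deriv V t := by
    filter_upwards [hVdiff, hfdiff] with t hVt hft ht n
    have htI : t ∈ Icc a b := Ioo_subset_Icc_self ht
    have hnhds : Icc a b ∈ 𝓝 t := Icc_mem_nhds ht.1 ht.2
    have hV' : HasDerivAt V (deriv V t) t :=
      ((hVt htI).differentiableAt hnhds).hasDerivAt
    have hV0 : 0 ≤ deriv V t := by
      rw [← derivWithin_of_mem_nhds hnhds]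
      exact hVmono.derivWithin_nonneg
    have hf' := (hft n (by rwa [uIcc_of_le hab])).hasDerivAt
    rw [← abs_of_nonneg hV0]
    refine le_of_tendsto_of_tendsto hf'.tendsto_abs_div hV'.tendsto_abs_div ?_
    filter_upwards [nhdsWithin_le_nhds hnhds] with s hs
    exact div_le_div_of_nonneg_right ((hfdist n s t).trans (hVdist s hs t htI)) (abs_nonneg _)
  have hmint : IntervalIntegrable m volume a b := by
    have hVint : IntervalIntegrable (deriv V) volume a b :=
      MonotoneOn.intervalIntegrable_deriv (by rwa [uIcc_of_le hab])
    refine hVint.mono_fun' ?_ ?_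
    · exact (Measurable.iSup fun n => (measurable_deriv (f n)).abs).aestronglyMeasurable
    · rw [uIoc_of_le hab, ← restrict_Ioo_eq_restrict_Ioc, EventuallyLE,
        ae_restrict_iff' measurableSet_Ioo]
      filter_upwards [hmbound] with t ht hmem
      rw [Real.norm_of_nonneg (Real.iSup_nonneg fun n => abs_nonneg _)]
      exact ciSup_le (ht hmem)
  have hdist : ∀ s ∈ Icc a b, ∀ t ∈ Icc a b, s ≤ t → dist (γ s) (γ t) ≤ ∫ r in s..t, m r := by
    intro s hs t ht hst
    have hsub : uIcc s t ⊆ uIcc a b := by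
      rw [uIcc_of_le hst, uIcc_of_le hab]
      exact Icc_subset_Icc hs.1 ht.2
    have hn : ∀ n, |f n t - f n s| ≤ ∫ r in s..t, m r := by
      intro n
      have hfn := (hf n).mono hsub
      rw [← hfn.integral_deriv_eq_sub]
      refine (intervalIntegral.abs_integral_le_integral_abs hst).trans ?_
      refine intervalIntegral.integral_mono_ae_restrict hst hfn.intervalIntegrable_deriv.abs
        (hmint.mono_set hsub) ?_
      rw [← restrict_Ioo_eq_restrict_Icc, EventuallyLE, ae_restrict_iff' measurableSet_Ioo]
      filter_upwards [hmbound] with r hr hmem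
      exact le_ciSup (f := fun n => |deriv (f n) r|)
        ⟨_, forall_mem_range.2 (hr ⟨hs.1.trans_lt hmem.1, hmem.2.trans_le ht.2⟩)⟩ n
    refine le_of_forall_pos_le_add fun ε hε => ?_
    obtain ⟨n, hn'⟩ := (TopologicalSpace.denseRange_denseSeq X).exists_dist_lt (γ t) (half_pos hε)
    have h1 := hn n
    have h2 : dist (γ s) (γ t) ≤ f n s + f n t := dist_triangle_right _ _ _
    have h3 : f n t < ε / 2 := hn'
    have h4 := abs_le.1 h1
    linarith
  have hdist' : ∀ s ∈ Icc a b, ∀ t ∈ Icc a b,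
      dist (γ s) (γ t) ≤ |(∫ r in a..s, m r) - ∫ r in a..t, m r| := by
    intro s hs t ht
    wlog hst : s ≤ t generalizing s t
    · rw [dist_comm, abs_sub_comm]
      exact this t ht s hs (le_of_not_ge hst)
    have hi : ∀ r ∈ Icc a b, IntervalIntegrable m volume a r := fun r hr =>
      hmint.mono_set (by rw [uIcc_of_le hab, uIcc_of_le hr.1]; exact Icc_subset_Icc_right hr.2)
    rw [abs_sub_comm, intervalIntegral.integral_interval_sub_left (hi t ht) (hi s hs)]
    exact (hdist s hs t ht hst).trans (le_abs_self _)
  filter_upwards [hmbound, hfdiff, hmint.ae_hasDerivAt_integral] with t hbt hft hint ht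
  have htI : t ∈ Icc a b := Ioo_subset_Icc_self ht
  have htu : t ∈ uIcc a b := by rwa [uIcc_of_le hab]
  have hnhds : Icc a b ∈ 𝓝 t := Icc_mem_nhds ht.1 ht.2
  refine ⟨m t, tendsto_order.2 ⟨fun c hc => ?_, fun c hc => ?_⟩⟩
  · obtain ⟨n, hn⟩ := exists_lt_of_lt_ciSup hc
    have h1 := (hft n htu).hasDerivAt.tendsto_abs_div
    filter_upwards [h1.eventually (lt_mem_nhds hn)] with s hs
    refine hs.trans_le ?_
    gcongr
    exact hfdist n s t
  · have h1 := (hint htu a (by simp)).tendsto_abs_div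
    rw [abs_of_nonneg (Real.iSup_nonneg fun n => abs_nonneg _)] at h1
    filter_upwards [h1.eventually (gt_mem_nhds hc), nhdsWithin_le_nhds hnhds] with s hs hsI
    refine lt_of_le_of_lt ?_ hs
    gcongr
    exact hdist' s hsI t htI

theorem AbsolutelyContinuousOnInterval.comp_add_right {X : Type*} [PseudoMetricSpace X]
    {f : ℝ → X} {a b : ℝ} (τ : ℝ) (hf : AbsolutelyContinuousOnInterval f (a + τ) (b + τ)) :
    AbsolutelyContinuousOnInterval (fun t => f (t + τ)) a b := by
  have huIcc : ∀ x ∈ uIcc a b, x + τ ∈ uIcc (a + τ) (b + τ) := by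
    intro x hx
    rw [mem_uIcc] at hx ⊢
    rcases hx with hx | hx
    · exact Or.inl ⟨by linarith, by linarith⟩
    · exact Or.inr ⟨by linarith, by linarith⟩
  have huIoc : ∀ x y z : ℝ, z ∈ uIoc (x + τ) (y + τ) → z - τ ∈ uIoc x y := by
    intro x y z hz
    rw [mem_uIoc] at hz ⊢
    rcases hz with hz | hz
    · exact Or.inl ⟨by linarith, by linarith⟩
    · exact Or.inr ⟨by linarith, by linarith⟩
  rw [absolutelyContinuousOnInterval_iff] at hf ⊢
  intro ε hε
  obtain ⟨δ, hδ, h⟩ := hf ε hε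
  refine ⟨δ, hδ, fun I hI hlen => ?_⟩
  refine h (I.1, fun i => ((I.2 i).1 + τ, (I.2 i).2 + τ)) ⟨fun i hi => ?_, ?_⟩ ?_
  · exact ⟨huIcc _ (hI.1 i hi).1, huIcc _ (hI.1 i hi).2⟩
  · intro i hi j hj hij
    refine Set.disjoint_left.2 fun z hzi hzj => ?_
    exact Set.disjoint_left.1 (hI.2 hi hj hij) (huIoc _ _ _ hzi) (huIoc _ _ _ hzj)
  · simpa using hlen

/-! ### The integrated EVI and monotonicity of the energy. -/

theorem hasDerivAt_integral_exp_mul {g : ℝ → ℝ} (hg : Continuous g) (lam s t : ℝ) :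
    HasDerivAt (fun x => ∫ r in s..x, Real.exp (lam * r) * g r) (Real.exp (lam * t) * g t) t := by
  have hc : Continuous fun r => Real.exp (lam * r) * g r := by fun_prop
  exact hc.integral_hasStrictDerivAt s t |>.hasDerivAt

namespace IsEVIFlow

variable {X : Type*} [MetricSpace X] {E : X → EReal} {lam : ℝ} {u v : ℝ → X}

theorem continuousAt (hu : IsEVIFlow E lam u) {t : ℝ} (ht : 0 < t) : ContinuousAt u t := by
  have h := (hu.ac_loc (t / 2) (2 * t) (by linarith) (by linarith)).continuousOn_of_metric
  rw [uIcc_of_le (by linarith)] at h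
  exact h.continuousAt (Icc_mem_nhds (by linarith) (by linarith))

theorem shift (hu : IsEVIFlow E lam u) {τ : ℝ} (hτ : 0 ≤ τ) :
    IsEVIFlow E lam (fun t => u (t + τ)) := by
  refine ⟨fun a b ha hab => ?_, fun y => ?_⟩
  · exact (hu.ac_loc (a + τ) (b + τ) (by linarith) (by linarith)).comp_add_right τ
  · have h := (measurePreserving_add_right volume τ).quasiMeasurePreserving.ae (hu.evi y)
    filter_upwards [h] with t ht htpos
    obtain ⟨D, hD, hle⟩ := ht (by linarith)
    exact ⟨D, hD.comp_add_const t τ, hle⟩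

/-- The integrated form of the evolution variational inequality. -/
theorem integral_le (hu : IsEVIFlow E lam u) (hbot : ∀ x, E x ≠ ⊥) {s t : ℝ} (hs : 0 < s)
    (hst : s ≤ t) {y : X} (hy : E y ≠ ⊤) {g : ℝ → ℝ} (hg : Continuous g)
    (hle : ∀ r ∈ Ioo s t, E y ≤ E (u r) + (g r : EReal)) :
    Real.exp (lam * t) / 2 * dist (u t) y ^ 2 - Real.exp (lam * s) / 2 * dist (u s) y ^ 2
      ≤ ∫ r in s..t, Real.exp (lam * r) * g r := by
  -- The factor `exp (lam * r)` absorbs the `lam`-term of the EVI, so `F` has nonpositive derivative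
  -- almost everywhere.
  set F : ℝ → ℝ := fun r => Real.exp (lam * r) / 2 * dist (u r) y ^ 2
    - ∫ q in s..r, Real.exp (lam * q) * g q with hF
  have hexp : AbsolutelyContinuousOnInterval (fun r => Real.exp (lam * r) / 2) s t :=
    ContDiffOn.absolutelyContinuousOnInterval (by fun_prop)
  have hd := (hu.ac_loc s t hs hst).dist_const y
  have hint : AbsolutelyContinuousOnInterval (fun r => ∫ q in s..r, Real.exp (lam * q) * g q) s t :=
    IntervalIntegrable.absolutelyContinuousOnInterval_intervalIntegral
      (Continuous.intervalIntegrable (by fun_prop) _ _) (by simp)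
  have hFac : AbsolutelyContinuousOnInterval F s t := by
    have := (hexp.fun_mul (hd.fun_mul hd)).fun_sub hint
    simpa only [hF, pow_two] using this
  have hfin : F t ≤ F s := by
    refine hFac.le_of_ae_deriv_nonpos hst ?_
    filter_upwards [hu.evi y] with r hr hmem
    obtain ⟨D, hD, hevi⟩ := hr (hs.trans hmem.1)
    have h1 : HasDerivAt (fun r => Real.exp (lam * r) / 2) (Real.exp (lam * r) * lam / 2) r := by
      have : HasDerivAt (fun r => lam * r) lam r := by
        simpa using (hasDerivAt_id r).const_mul lam
      exact this.exp.div_const 2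
    refine ⟨_, (h1.mul hD).sub (hasDerivAt_integral_exp_mul hg lam s r), ?_⟩
    have hle' := hevi.trans (hle r hmem)
    have htop : E (u r) ≠ ⊤ := by
      intro h
      rw [h, EReal.add_top_of_ne_bot (EReal.coe_ne_bot _), top_le_iff] at hevi
      exact hy hevi
    lift E (u r) to ℝ using ⟨htop, hbot _⟩ with e
    rw [← EReal.coe_add, ← EReal.coe_add, EReal.coe_le_coe_iff] at hle'
    have hpos := Real.exp_pos (lam * r)
    nlinarith
  simp only [hF, intervalIntegral.integral_same] at hfin
  linarith

/-- If the energy at `t` were larger, take the last time `q` at which it is at most its value at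
`s`. After `q` it exceeds `E (u q)`, and the EVI tested at `u q` forces `u t = u q`, a
contradiction. -/
theorem antitone (hu : IsEVIFlow E lam u) (hbot : ∀ x, E x ≠ ⊥) (hlsc : LowerSemicontinuous E)
    {s t : ℝ} (hs : 0 < s) (hst : s ≤ t) : E (u t) ≤ E (u s) := by
  by_contra! hlt
  have hcont : ContinuousOn u (Icc s t) := fun r hr =>
    (hu.continuousAt (hs.trans_le hr.1)).continuousWithinAt
  have hclosed : IsClosed {r | r ∈ Icc s t ∧ E (u r) ≤ E (u s)} := by
    have := hcont.preimage_isClosed_of_isClosed isClosed_Icc (hlsc.isClosed_preimage (E (u s)))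
    exact this
  have hcomp : IsCompact {r | r ∈ Icc s t ∧ E (u r) ≤ E (u s)} :=
    isCompact_Icc.of_isClosed_subset hclosed fun r hr => hr.1
  obtain ⟨q, ⟨hq, hqE⟩, hmax⟩ := hcomp.exists_isGreatest ⟨s, left_mem_Icc.2 hst, le_rfl⟩
  have hgt : ∀ r ∈ Ioo q t, E (u q) ≤ E (u r) + ((0 : ℝ) : EReal) := by
    intro r hr
    rw [EReal.coe_zero, add_zero]
    refine hqE.trans (le_of_not_ge fun h => ?_)
    exact absurd (hmax ⟨⟨hq.1.trans hr.1.le, hr.2.le⟩, h⟩) (not_le.2 hr.1)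
  have h := hu.integral_le hbot (hs.trans_le hq.1) hq.2 (hqE.trans_lt (hlt.trans_le le_top)).ne
    continuous_const hgt
  simp only [dist_self, mul_zero, intervalIntegral.integral_zero] at h
  have hpos := Real.exp_pos (lam * t)
  have hd : dist (u t) (u q) ^ 2 ≤ 0 := by nlinarith
  have hd0 : dist (u t) (u q) = 0 := pow_eq_zero_iff two_ne_zero |>.1 (le_antisymm hd (sq_nonneg _))
  rw [dist_eq_zero.1 hd0] at hlt
  exact absurd hqE (not_le.2 hlt)

/-- The EVI with a test point of finite energy gives finiteness at almost every earlier time;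
monotonicity carries it to `t`. -/
theorem energy_ne_top (hu : IsEVIFlow E lam u) (hbot : ∀ x, E x ≠ ⊥)
    (hlsc : LowerSemicontinuous E) (hdom : ∃ y, E y ≠ ⊤) {t : ℝ} (ht : 0 < t) :
    E (u t) ≠ ⊤ := by
  obtain ⟨y, hy⟩ := hdom
  have hpos : (volume.restrict (Ioo 0 t)) ≠ 0 := by
    rw [Ne, Measure.restrict_eq_zero, Real.volume_Ioo]
    simpa using ht
  have hae := ae_restrict_of_ae (s := Ioo 0 t) (hu.evi y)
  have : (ae (volume.restrict (Ioo 0 t))).NeBot := ae_neBot.2 hpos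
  obtain ⟨r, hr, hmem⟩ := (hae.and (ae_restrict_mem measurableSet_Ioo)).exists
  obtain ⟨D, -, hevi⟩ := hr hmem.1
  intro htop
  have h := hu.antitone hbot hlsc hmem.1 hmem.2.le
  rw [htop, top_le_iff] at h
  rw [h, EReal.add_top_of_ne_bot (EReal.coe_ne_bot _), top_le_iff] at hevi
  exact hy hevi

end IsEVIFlow

theorem EVISetting.coe_toReal {X : Type*} [MetricSpace X] {E : X → EReal} {lam : ℝ}
    (hE : EVISetting E lam) {x : X} (hx : E x ≠ ⊤) : ((E x).toReal : EReal) = E x :=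
  EReal.coe_toReal hx (hE.ne_bot x)

theorem hasDerivAt_integral_exp (lam s t : ℝ) :
    HasDerivAt (fun x => ∫ r in s..x, Real.exp (lam * r)) (Real.exp (lam * t)) t := by
  simpa using hasDerivAt_integral_exp_mul (g := fun _ => 1) continuous_const lam s t

theorem integral_exp_pos (lam : ℝ) {s t : ℝ} (hst : s < t) :
    0 < ∫ r in s..t, Real.exp (lam * r) :=
  intervalIntegral.intervalIntegral_pos_of_pos
    (Continuous.intervalIntegrable (by fun_prop) _ _) (fun _ => Real.exp_pos _) hst

theorem tendsto_integral_exp_div (lam t : ℝ) :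
    Tendsto (fun s => (∫ r in t..s, Real.exp (lam * r)) / (s - t)) (𝓝[≠] t)
      (𝓝 (Real.exp (lam * t))) := by
  refine (hasDerivAt_iff_tendsto_slope.1 (hasDerivAt_integral_exp lam t t)).congr fun s => ?_
  rw [slope_def_field, intervalIntegral.integral_same, sub_zero]

/-! ### Contraction of flows and the slope bound from the right speed. -/

namespace IsEVIFlow

variable {X : Type*} [MetricSpace X] {E : X → EReal} {lam : ℝ} {u v : ℝ → X}

theorem ne_top (hu : IsEVIFlow E lam u) (hE : EVISetting E lam) {t : ℝ} (ht : 0 < t) :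
    E (u t) ≠ ⊤ := by
  have : Nonempty X := ⟨u 0⟩
  exact hu.energy_ne_top hE.ne_bot hE.lsc hE.dense_domain.nonempty ht

theorem integral_le_toReal (hu : IsEVIFlow E lam u) (hE : EVISetting E lam) {s t : ℝ} (hs : 0 < s)
    (hst : s ≤ t) {y : X} (hy : E y ≠ ⊤) {g : ℝ → ℝ} (hg : Continuous g)
    (hle : ∀ r ∈ Ioo s t, (E y).toReal ≤ (E (u r)).toReal + g r) :
    Real.exp (lam * t) / 2 * dist (u t) y ^ 2 - Real.exp (lam * s) / 2 * dist (u s) y ^ 2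
      ≤ ∫ r in s..t, Real.exp (lam * r) * g r := by
  refine hu.integral_le hE.ne_bot hs hst hy hg fun r hr => ?_
  rw [← hE.coe_toReal hy, ← hE.coe_toReal (hu.ne_top hE (hs.trans hr.1)), ← EReal.coe_add,
    EReal.coe_le_coe_iff]
  exact hle r hr

theorem toReal_antitoneOn (hu : IsEVIFlow E lam u) (hE : EVISetting E lam) :
    AntitoneOn (fun t => (E (u t)).toReal) (Ioi 0) := fun _ hs _ _ hst =>
  EReal.toReal_le_toReal (hu.antitone hE.ne_bot hE.lsc hs hst) (hE.ne_bot _) (hu.ne_top hE hs)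

theorem evi_toReal (hu : IsEVIFlow E lam u) (hE : EVISetting E lam) {s t : ℝ} (hs : 0 < s)
    (hst : s ≤ t) {y : X} (hy : E y ≠ ⊤) :
    Real.exp (lam * t) / 2 * dist (u t) y ^ 2 - Real.exp (lam * s) / 2 * dist (u s) y ^ 2
      ≤ ((E y).toReal - (E (u t)).toReal) * ∫ r in s..t, Real.exp (lam * r) := by
  have h := hu.integral_le_toReal hE hs hst hy
    (g := fun _ => (E y).toReal - (E (u t)).toReal) continuous_const fun r hr => by
      have := hu.toReal_antitoneOn hE (hs.trans hr.1 : 0 < r) (hs.trans_le hst : 0 < t) hr.2.le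
      simp only at this
      linarith
  rwa [intervalIntegral.integral_mul_const, mul_comm (∫ r in s..t, Real.exp (lam * r))] at h

theorem ae_continuousAt_toReal (hu : IsEVIFlow E lam u) (hE : EVISetting E lam) :
    ∀ᵐ t : ℝ, 0 < t → ContinuousAt (fun t => (E (u t)).toReal) t := by
  have hmono : MonotoneOn (fun t => -(E (u t)).toReal) (Ioi 0) := (hu.toReal_antitoneOn hE).neg
  filter_upwards [hmono.ae_differentiableWithinAt_of_mem] with t ht htpos
  have h := ((ht htpos).differentiableAt (Ioi_mem_nhds htpos)).continuousAt.neg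
  exact h.congr (Eventually.of_forall fun s => neg_neg _)

/-- The EVI on `[r, q]` is used for `u` tested at `v q` and for `v` tested at `u r`. With weights
`exp (lam * q)` and `exp (lam * r)` the mixed distance cancels. What remains is `G q` times an
integral of order `q - r`, and `G q → 0` wherever both energies are continuous, hence almost
everywhere. -/
theorem sq_contraction (hu : IsEVIFlow E lam u) (hv : IsEVIFlow E lam v) (hE : EVISetting E lam)
    {s t : ℝ} (hs : 0 < s) (hst : s ≤ t) :
    Real.exp (lam * t) ^ 2 * dist (u t) (v t) ^ 2 ≤ Real.exp (lam * s) ^ 2 * dist (u s) (v s) ^ 2 := by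
  set F : ℝ → ℝ := fun r => Real.exp (lam * r) ^ 2 * dist (u r) (v r) ^ 2 with hF
  have hexp : AbsolutelyContinuousOnInterval (fun r => Real.exp (lam * r) ^ 2) s t :=
    ContDiffOn.absolutelyContinuousOnInterval (by fun_prop)
  have hd := (hu.ac_loc s t hs hst).dist_comp (hv.ac_loc s t hs hst)
  have hFac : AbsolutelyContinuousOnInterval F s t := by
    have := hexp.fun_mul (hd.fun_mul hd)
    simpa only [hF, pow_two] using this
  refine hFac.le_of_ae_deriv_nonpos hst ?_
  filter_upwards [hFac.ae_differentiableAt, hu.ae_continuousAt_toReal hE,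
    hv.ae_continuousAt_toReal hE] with r hr hφ hψ hmem
  have hrpos : 0 < r := hs.trans hmem.1
  have hder := (hr (by rw [uIcc_of_le hst]; exact Ioo_subset_Icc_self hmem)).hasDerivAt
  refine ⟨_, hder, ?_⟩
  set φ : ℝ → ℝ := fun t => (E (u t)).toReal with hφdef
  set ψ : ℝ → ℝ := fun t => (E (v t)).toReal with hψdef
  set G : ℝ → ℝ := fun q => Real.exp (lam * q) * (ψ q - φ q) + Real.exp (lam * r) * (φ r - ψ q)
    with hG
  have hGcont : ContinuousAt G r := by
    have h1 := hφ hrpos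
    have h2 := hψ hrpos
    have h3 : ContinuousAt (fun q => Real.exp (lam * q)) r := by fun_prop
    exact (h3.mul (h2.sub h1)).add (continuousAt_const.mul (continuousAt_const.sub h2))
  have hG0 : G r = 0 := by simp only [hG]; ring
  have hlim : Tendsto (fun q => 2 * ((∫ x in r..q, Real.exp (lam * x)) / (q - r) * G q)) (𝓝[>] r)
      (𝓝 (2 * (Real.exp (lam * r) * 0))) := by
    refine Tendsto.const_mul 2 (((tendsto_integral_exp_div lam r).mono_left
      (nhdsGT_le_nhdsNE r)).mul ?_)
    rw [← hG0]
    exact hGcont.tendsto.mono_left nhdsWithin_le_nhds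
  have hslope := (hasDerivAt_iff_tendsto_slope.1 hder).mono_left
    (nhdsGT_le_nhdsNE r)
  rw [mul_zero, mul_zero] at hlim
  refine le_of_tendsto_of_tendsto hslope hlim ?_
  filter_upwards [self_mem_nhdsWithin] with q hq
  have hq : r < q := hq
  rw [slope_def_field, div_mul_eq_mul_div, mul_div_assoc']
  refine div_le_div_of_nonneg_right ?_ (sub_nonneg.2 hq.le)
  have h1 := hu.evi_toReal hE hrpos hq.le (hv.ne_top hE (hrpos.trans hq))
  have h2 := hv.evi_toReal hE hrpos hq.le (hu.ne_top hE hrpos)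
  rw [dist_comm (v q), dist_comm (v r)] at h2
  have h1' := mul_le_mul_of_nonneg_left h1 (Real.exp_pos (lam * q)).le
  have h2' := mul_le_mul_of_nonneg_left h2 (Real.exp_pos (lam * r)).le
  simp only [hF, hG, hφdef, hψdef]
  nlinarith

theorem contraction (hu : IsEVIFlow E lam u) (hv : IsEVIFlow E lam v) (hE : EVISetting E lam)
    {s t : ℝ} (hs : 0 < s) (hst : s ≤ t) :
    Real.exp (lam * t) * dist (u t) (v t) ≤ Real.exp (lam * s) * dist (u s) (v s) := by
  have h := hu.sq_contraction hv hE hs hst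
  rw [← mul_pow, ← mul_pow] at h
  exact (pow_le_pow_iff_left₀ (by positivity) (by positivity) two_ne_zero).1 h

/-- A bound on the right speed of the flow at `t` bounds the global slope of `E` at `u t`. -/
theorem toReal_le_of_right_speed_le (hu : IsEVIFlow E lam u) (hE : EVISetting E lam) {t L : ℝ}
    (ht : 0 < t) (hL : ∀ᶠ s in 𝓝[>] t, dist (u s) (u t) ≤ L * (s - t)) {z : X} (hz : E z ≠ ⊤) :
    (E (u t)).toReal ≤ (E z).toReal + L * dist (u t) z - lam / 2 * dist (u t) z ^ 2 := by
  set d := dist (u t) z with hd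
  have hL0 : 0 ≤ L := by
    obtain ⟨s, hs, hs'⟩ := (hL.and self_mem_nhdsWithin).exists
    have hs' : t < s := hs'
    by_contra! hneg
    have := dist_nonneg (x := u s) (y := u t)
    nlinarith
  have hexp : HasDerivAt (fun s => Real.exp (lam * s)) (Real.exp (lam * t) * lam) t := by
    have : HasDerivAt (fun r => lam * r) lam t := by
      simpa using (hasDerivAt_id t).const_mul lam
    exact this.exp
  have hmono : 𝓝[>] t ≤ 𝓝[≠] t := nhdsGT_le_nhdsNE t
  have h1 := (hasDerivAt_iff_tendsto_slope.1 hexp).mono_left hmono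
  have h2 := (tendsto_integral_exp_div lam t).mono_left hmono
  have h3 : Tendsto (fun s => Real.exp (lam * s)) (𝓝[>] t) (𝓝 (Real.exp (lam * t))) :=
    hexp.continuousAt.tendsto.mono_left nhdsWithin_le_nhds
  have hne := (Real.exp_pos (lam * t)).ne'
  -- The upper bound for `E (u s)` obtained from the EVI on `[t, s]` tested at `z`, using `dist (u
  -- s) z ≥ d - L * (s - t)`.
  set R : ℝ → ℝ := fun s => (E z).toReal + (Real.exp (lam * s) * (d * L)
    - d ^ 2 / 2 * slope (fun s => Real.exp (lam * s)) t s)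
      / ((∫ r in t..s, Real.exp (lam * r)) / (s - t)) with hR
  have hRlim : Tendsto R (𝓝[>] t) (𝓝 ((E z).toReal + L * d - lam / 2 * d ^ 2)) := by
    have := (((h3.mul_const (d * L)).sub (h1.const_mul (d ^ 2 / 2))).div h2 hne).const_add
      (E z).toReal
    refine this.trans (le_of_eq ?_)
    congr 1
    field_simp
    ring
  have hle : ∀ᶠ s in 𝓝[>] t, (E (u s)).toReal ≤ R s := by
    filter_upwards [hL, self_mem_nhdsWithin] with s hs hts
    have hts : t < s := hts
    have hevi := hu.evi_toReal hE ht hts.le hz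
    have hJ := integral_exp_pos lam hts
    have hst : 0 < s - t := sub_pos.2 hts
    have htri : d ≤ dist (u s) (u t) + dist (u s) z := by
      rw [dist_comm (u s) (u t)]; exact dist_triangle _ _ _
    have hd0 : 0 ≤ d := dist_nonneg
    have hds : 0 ≤ dist (u s) z := dist_nonneg
    have hsq : d ^ 2 - 2 * d * (L * (s - t)) ≤ dist (u s) z ^ 2 := by
      have h4 : d - L * (s - t) ≤ dist (u s) z := by linarith
      rcases le_total (L * (s - t)) d with h5 | h5
      · have := pow_le_pow_left₀ (sub_nonneg.2 h5) h4 2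
        nlinarith [sq_nonneg (L * (s - t))]
      · nlinarith
    simp only [hR]
    rw [← sub_le_iff_le_add', slope_def_field, div_div_eq_mul_div, le_div_iff₀ hJ]
    have h6 : (Real.exp (lam * s) * (d * L)
        - d ^ 2 / 2 * ((Real.exp (lam * s) - Real.exp (lam * t)) / (s - t))) * (s - t)
        = Real.exp (lam * s) * (d * L) * (s - t)
          - d ^ 2 / 2 * (Real.exp (lam * s) - Real.exp (lam * t)) := by
      field_simp
    rw [h6]
    have hes := Real.exp_pos (lam * s)
    nlinarith
  -- The bound is known only for `s > t`; lower semicontinuity along `u s → u t` transfers it to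
  -- time `t`.
  have hE' : E (u t) ≤ (((E z).toReal + L * d - lam / 2 * d ^ 2 : ℝ) : EReal) := by
    refine le_of_forall_lt fun c hc => ?_
    obtain ⟨c', hcc', hc'⟩ := EReal.lt_iff_exists_real_btwn.1 hc
    refine hcc'.trans_le (EReal.coe_le_coe_iff.2 ?_)
    have hev : ∀ᶠ s in 𝓝[>] t, (c' : EReal) < E (u s) :=
      ((hu.continuousAt ht).tendsto.eventually (hE.lsc (u t) _ hc')).filter_mono nhdsWithin_le_nhds
    refine ge_of_tendsto hRlim ?_
    filter_upwards [hev, hle, self_mem_nhdsWithin] with s hs hs' hts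
    rw [← hE.coe_toReal (hu.ne_top hE (ht.trans hts)), EReal.coe_lt_coe_iff] at hs
    linarith
  rwa [← hE.coe_toReal (hu.ne_top hE ht), EReal.coe_le_coe_iff] at hE'

end IsEVIFlow

/-! ### Lipschitz regularity in time and dissipation of energy. -/

theorem exp_mul_le_exp_abs_mul {lam r T : ℝ} (h0 : 0 ≤ r) (hr : r ≤ T) :
    Real.exp (lam * r) ≤ Real.exp (|lam| * T) := by
  refine Real.exp_le_exp.2 ?_
  calc lam * r ≤ |lam| * r := mul_le_mul_of_nonneg_right (le_abs_self _) h0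
    _ ≤ |lam| * T := mul_le_mul_of_nonneg_left hr (abs_nonneg _)

theorem one_le_exp_abs_mul_mul_exp {lam r T : ℝ} (h0 : 0 ≤ r) (hr : r ≤ T) :
    1 ≤ Real.exp (|lam| * T) * Real.exp (lam * r) := by
  rw [← Real.exp_add]
  refine Real.one_le_exp ?_
  have h1 : -|lam| * r ≤ lam * r := mul_le_mul_of_nonneg_right (neg_abs_le _) h0
  have h2 : |lam| * r ≤ |lam| * T := mul_le_mul_of_nonneg_left hr (abs_nonneg _)
  linarith

theorem integral_exp_le {lam s t T : ℝ} (hs : 0 ≤ s) (hst : s ≤ t) (ht : t ≤ T) :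
    ∫ r in s..t, Real.exp (lam * r) ≤ Real.exp (|lam| * T) * (t - s) := by
  have h := intervalIntegral.integral_mono_on (μ := volume) hst
    (f := fun r => Real.exp (lam * r)) (g := fun _ => Real.exp (|lam| * T))
    (Continuous.intervalIntegrable (by fun_prop) _ _)
    (Continuous.intervalIntegrable (by fun_prop) _ _)
    fun r hr => exp_mul_le_exp_abs_mul (hs.trans hr.1) (hr.2.trans ht)
  rw [intervalIntegral.integral_const, smul_eq_mul] at h
  linarith

namespace IsEVIFlow

variable {X : Type*} [MetricSpace X] {E : X → EReal} {lam : ℝ} {u v : ℝ → X}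

/-- Contraction between the flow and its shift by `τ` moves the estimate from `t` back to `s`, where
the EVI tested at `u s` applies. Of the six exponential factors, four come from the squared
contraction and two from the EVI. -/
theorem dist_add_sq_le (hu : IsEVIFlow E lam u) (hE : EVISetting E lam) {s t τ T : ℝ}
    (hs : 0 < s) (hst : s ≤ t) (hτ : 0 ≤ τ) (htT : t + τ ≤ T) :
    dist (u (t + τ)) (u t) ^ 2 ≤ 2 * Real.exp (|lam| * T) ^ 6 * τ *
      ((E (u s)).toReal - (E (u (s + τ))).toReal) := by
  set A := Real.exp (|lam| * T) with hA
  have hA0 : 0 < A := Real.exp_pos _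
  set φ := (E (u s)).toReal - (E (u (s + τ))).toReal with hφ
  have hφ0 : 0 ≤ φ := sub_nonneg.2
    (hu.toReal_antitoneOn hE (show (0:ℝ) < s from hs) (show (0 : ℝ) < s + τ by linarith)
      (by linarith))
  have h1 := (hu.shift hτ).contraction hu hE hs hst
  have h2 := hu.evi_toReal hE hs (show s ≤ s + τ by linarith) (hu.ne_top hE hs)
  rw [dist_self] at h2
  have h3 := integral_exp_le (lam := lam) hs.le (show s ≤ s + τ by linarith)
    (show s + τ ≤ T by linarith)
  have h4 : dist (u (t + τ)) (u t) ≤ A ^ 2 * dist (u (s + τ)) (u s) := by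
    have h5 := one_le_exp_abs_mul_mul_exp (lam := lam) (hs.le.trans hst) (show t ≤ T by linarith)
    have h6 := exp_mul_le_exp_abs_mul (lam := lam) hs.le (show s ≤ T by linarith)
    rw [← hA] at h5 h6
    have hd := dist_nonneg (x := u (t + τ)) (y := u t)
    have hd' := dist_nonneg (x := u (s + τ)) (y := u s)
    calc dist (u (t + τ)) (u t) ≤ A * Real.exp (lam * t) * dist (u (t + τ)) (u t) :=
          le_mul_of_one_le_left hd h5
      _ ≤ A * (Real.exp (lam * s) * dist (u (s + τ)) (u s)) := by
          rw [mul_assoc]; exact mul_le_mul_of_nonneg_left h1 hA0.le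
      _ ≤ A * (A * dist (u (s + τ)) (u s)) := by gcongr
      _ = A ^ 2 * dist (u (s + τ)) (u s) := by ring
  have h5 : dist (u (s + τ)) (u s) ^ 2 ≤ 2 * A ^ 2 * τ * φ := by
    have h6 := one_le_exp_abs_mul_mul_exp (lam := lam) (show 0 ≤ s + τ by linarith)
      (show s + τ ≤ T by linarith)
    have h7 : φ * ∫ r in s..s + τ, Real.exp (lam * r) ≤ φ * (A * τ) :=
      mul_le_mul_of_nonneg_left (by linarith) hφ0
    calc dist (u (s + τ)) (u s) ^ 2
        ≤ A * Real.exp (lam * (s + τ)) * dist (u (s + τ)) (u s) ^ 2 :=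
          le_mul_of_one_le_left (sq_nonneg _) h6
      _ = 2 * A * (Real.exp (lam * (s + τ)) / 2 * dist (u (s + τ)) (u s) ^ 2) := by ring
      _ ≤ 2 * A * (φ * (A * τ)) := mul_le_mul_of_nonneg_left (by linarith) (by positivity)
      _ = 2 * A ^ 2 * τ * φ := by ring
  calc dist (u (t + τ)) (u t) ^ 2 ≤ (A ^ 2 * dist (u (s + τ)) (u s)) ^ 2 :=
        pow_le_pow_left₀ dist_nonneg h4 2
    _ = A ^ 4 * dist (u (s + τ)) (u s) ^ 2 := by ring
    _ ≤ A ^ 4 * (2 * A ^ 2 * τ * φ) := mul_le_mul_of_nonneg_left h5 (by positivity)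
    _ = 2 * A ^ 6 * τ * φ := by ring

/-- Quantitative local Lipschitz regularity of a flow, in terms of the energy it dissipates. -/
theorem dist_sq_le_of_energy_osc (hu : IsEVIFlow E lam u) (hE : EVISetting E lam) {a c C M : ℝ}
    (ha : 0 < a) (hac : a < c) (hM : (E (u a)).toReal - (E (u C)).toReal ≤ M) {t τ : ℝ}
    (hct : c ≤ t) (hτ : 0 ≤ τ) (htC : t + τ ≤ C) :
    dist (u (t + τ)) (u t) ^ 2 ≤ 4 * Real.exp (|lam| * C) ^ 6 * M / (c - a) * τ ^ 2 := by
  set Q := 2 * Real.exp (|lam| * C) ^ 6 with hQ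
  have hQ0 : 0 < Q := by positivity
  set w := dist (u (t + τ)) (u t) ^ 2 with hw
  have hw0 : 0 ≤ w := sq_nonneg _
  have hanti := hu.toReal_antitoneOn hE
  rcases hτ.eq_or_lt with rfl | hτpos
  · simp [hw]
  have hca : 0 < c - a := sub_pos.2 hac
  have hM0 : 0 ≤ M := le_trans (sub_nonneg.2
    (hanti ha (show (0 : ℝ) < C by linarith) (by linarith))) hM
  suffices h : (c - a) * w ≤ 2 * Q * M * τ ^ 2 by
    rw [div_mul_eq_mul_div, le_div_iff₀ hca]
    linarith
  rcases le_or_gt τ (c - a) with hle | hgt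
  -- The same displacement is bounded by the energy drop over each of `N` consecutive steps of
  -- length `τ` inside `[a, c]`. The drops telescope to at most `M`, which gains the second factor
  -- `τ`; `N ≥ 1` gives `c - a ≤ 2 * N * τ`.
  · set N := ⌊(c - a) / τ⌋₊ with hN
    have hN1 : (N : ℝ) * τ ≤ c - a := by
      rw [← le_div_iff₀ hτpos]
      exact Nat.floor_le (by positivity)
    have hN2 : c - a < (N + 1) * τ := by
      rw [← div_lt_iff₀ hτpos]
      exact Nat.lt_floor_add_one _
    have hN3 : 1 ≤ N := by
      rw [hN, Nat.one_le_floor_iff, le_div_iff₀ hτpos]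
      linarith
    have hN3' : (1 : ℝ) ≤ N := by exact_mod_cast hN3
    have hsum : ∑ i ∈ Finset.range N, w ≤ ∑ i ∈ Finset.range N, Q * τ *
        ((E (u (a + i * τ))).toReal - (E (u (a + (i + 1 : ℕ) * τ))).toReal) := by
      refine Finset.sum_le_sum fun i hi => ?_
      have hi : ((i + 1 : ℕ) : ℝ) ≤ N := by exact_mod_cast Finset.mem_range.1 hi
      have h0 : 0 ≤ (i : ℝ) * τ := by positivity
      push_cast at hi ⊢
      have h := hu.dist_add_sq_le hE (s := a + i * τ) (t := t) (T := C) (by linarith)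
        (by nlinarith) hτ htC
      rwa [show a + (i : ℝ) * τ + τ = a + (i + 1) * τ by ring] at h
    rw [← Finset.mul_sum, Finset.sum_range_sub'
      (fun i : ℕ => (E (u (a + i * τ))).toReal), Finset.sum_const, Finset.card_range,
      nsmul_eq_mul] at hsum
    simp only [Nat.cast_zero, zero_mul, add_zero] at hsum
    have hend : (E (u C)).toReal ≤ (E (u (a + N * τ))).toReal :=
      hanti (show (0 : ℝ) < a + N * τ by positivity) (show (0 : ℝ) < C by linarith) (by linarith)
    have h1 : (N : ℝ) * w ≤ Q * τ * M :=
      hsum.trans (mul_le_mul_of_nonneg_left (by linarith) (by positivity))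
    have h2 : c - a ≤ 2 * N * τ := by nlinarith
    calc (c - a) * w ≤ 2 * N * τ * w := mul_le_mul_of_nonneg_right h2 hw0
      _ = 2 * τ * (N * w) := by ring
      _ ≤ 2 * τ * (Q * τ * M) := mul_le_mul_of_nonneg_left h1 (by positivity)
      _ = 2 * Q * M * τ ^ 2 := by ring
  · have h := hu.dist_add_sq_le hE (ha.trans (hac.trans_le hct)) le_rfl hτ htC
    have h1 : (E (u t)).toReal ≤ (E (u a)).toReal :=
      hanti ha (show (0 : ℝ) < t by linarith) (by linarith)
    have h2 : (E (u C)).toReal ≤ (E (u (t + τ))).toReal :=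
      hanti (show (0 : ℝ) < t + τ by linarith) (show (0 : ℝ) < C by linarith) (by linarith)
    have h3 : w ≤ Q * τ * M := h.trans (mul_le_mul_of_nonneg_left (by linarith) (by positivity))
    calc (c - a) * w ≤ τ * (Q * τ * M) := mul_le_mul hgt.le h3 hw0 hτ
      _ ≤ 2 * Q * M * τ ^ 2 := by nlinarith [mul_nonneg (mul_nonneg hQ0.le hM0) (sq_nonneg τ)]

theorem dist_le_of_energy_osc (hu : IsEVIFlow E lam u) (hE : EVISetting E lam) {a c C M : ℝ}
    (ha : 0 < a) (hac : a < c) (hM : (E (u a)).toReal - (E (u C)).toReal ≤ M) {s t : ℝ}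
    (hs : s ∈ Icc c C) (ht : t ∈ Icc c C) :
    dist (u s) (u t) ≤ √(4 * Real.exp (|lam| * C) ^ 6 * M / (c - a)) * |s - t| := by
  wlog hst : t ≤ s generalizing s t
  · rw [dist_comm, abs_sub_comm]
    exact this ht hs (le_of_not_ge hst)
  have hM0 : 0 ≤ M := le_trans (sub_nonneg.2 (hu.toReal_antitoneOn hE ha
    (show (0 : ℝ) < C by linarith [hs.1, hs.2]) (by linarith [hs.1, hs.2]))) hM
  have hca : 0 < c - a := sub_pos.2 hac
  have h := hu.dist_sq_le_of_energy_osc hE ha hac hM ht.1 (sub_nonneg.2 hst) (by linarith [hs.2])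
  rw [add_sub_cancel] at h
  rw [abs_of_nonneg (sub_nonneg.2 hst)]
  refine (pow_le_pow_iff_left₀ dist_nonneg
    (mul_nonneg (Real.sqrt_nonneg _) (sub_nonneg.2 hst)) two_ne_zero).1 ?_
  rwa [mul_pow, Real.sq_sqrt (by positivity)]

theorem toReal_le_of_lipschitz (hu : IsEVIFlow E lam u) (hE : EVISetting E lam) {c C L : ℝ}
    (hc : 0 < c) (hL : ∀ s ∈ Icc c C, ∀ t ∈ Icc c C, dist (u s) (u t) ≤ L * |s - t|) {t : ℝ}
    (ht : t ∈ Ico c C) {z : X} (hz : E z ≠ ⊤) :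
    (E (u t)).toReal ≤ (E z).toReal + L * dist (u t) z - lam / 2 * dist (u t) z ^ 2 := by
  refine hu.toReal_le_of_right_speed_le hE (hc.trans_le ht.1) ?_ hz
  filter_upwards [Ioo_mem_nhdsGT ht.2] with s hs
  have h := hL s ⟨ht.1.trans hs.1.le, hs.2.le⟩ t ⟨ht.1, ht.2.le⟩
  rwa [abs_of_pos (sub_pos.2 hs.1)] at h

theorem absolutelyContinuous_toReal (hu : IsEVIFlow E lam u) (hE : EVISetting E lam) {a b : ℝ}
    (ha : 0 < a) (hab : a ≤ b) :
    AbsolutelyContinuousOnInterval (fun t => (E (u t)).toReal) a b := by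
  -- The Lipschitz bound extends past `b` because the slope estimate at `b` needs the speed to its
  -- right.
  set L := √(4 * Real.exp (|lam| * (b + 1)) ^ 6 *
    ((E (u (a / 2))).toReal - (E (u (b + 1))).toReal) / (a - a / 2)) with hL
  have hlip : ∀ s ∈ Icc a (b + 1), ∀ t ∈ Icc a (b + 1), dist (u s) (u t) ≤ L * |s - t| :=
    fun s hs t ht => hu.dist_le_of_energy_osc hE (half_pos ha) (half_lt_self ha) le_rfl hs ht
  have hid : AbsolutelyContinuousOnInterval (fun t : ℝ => t) a b :=
    LipschitzWith.id.lipschitzOnWith.absolutelyContinuousOnInterval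
  have hL0 : 0 ≤ L := Real.sqrt_nonneg _
  have key : ∀ s ∈ Icc a b, ∀ t ∈ Icc a b, (E (u t)).toReal - (E (u s)).toReal
      ≤ (L ^ 2 + |lam| / 2 * (L ^ 2 * (b - a))) * |s - t| := by
    intro s hs t ht
    have h1 := hu.toReal_le_of_lipschitz hE ha hlip (t := t) ⟨ht.1, by linarith [ht.2]⟩
      (hu.ne_top hE (ha.trans_le hs.1))
    have h2 := hlip t ⟨ht.1, by linarith [ht.2]⟩ s ⟨hs.1, by linarith [hs.2]⟩
    rw [abs_sub_comm] at h2
    set d := dist (u t) (u s) with hd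
    have hd0 : 0 ≤ d := dist_nonneg
    have h3 : |s - t| ≤ b - a := by
      rw [abs_le]; constructor <;> linarith [hs.1, hs.2, ht.1, ht.2]
    have h0 := abs_nonneg (s - t)
    have h4 : d ^ 2 ≤ L ^ 2 * (b - a) * |s - t| := by
      calc d ^ 2 ≤ (L * |s - t|) ^ 2 := pow_le_pow_left₀ hd0 h2 2
        _ = L ^ 2 * (|s - t| * |s - t|) := by ring
        _ ≤ L ^ 2 * ((b - a) * |s - t|) := by gcongr
        _ = _ := by ring
    have h5 : -(lam / 2) * d ^ 2 ≤ |lam| / 2 * d ^ 2 := by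
      have := neg_abs_le lam
      exact mul_le_mul_of_nonneg_right (by linarith) (sq_nonneg d)
    have h6 : |lam| / 2 * d ^ 2 ≤ |lam| / 2 * (L ^ 2 * (b - a) * |s - t|) := by gcongr
    have h7 : L * d ≤ L * (L * |s - t|) := by gcongr
    nlinarith
  refine .of_dist_le (L ^ 2 + |lam| / 2 * (L ^ 2 * (b - a))) 0 hid hid fun s hs t ht => ?_
  rw [uIcc_of_le hab] at hs ht
  rw [zero_mul, add_zero, Real.dist_eq, Real.dist_eq, abs_le]
  have h1 := key s hs t ht
  have h2 := key t ht s hs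
  rw [abs_sub_comm] at h2
  constructor <;> linarith

/-- Along a piece of the flow on which the slope of `E` exceeds `c`, the energy decreases at rate
at least `c ^ 2`. -/
theorem energy_dissipation (hu : IsEVIFlow E lam u) (hE : EVISetting E lam) {a b c : ℝ}
    (ha : 0 < a) (hab : a ≤ b) (hc : 0 ≤ c)
    (hsteep : ∀ t ∈ Ioo a b, ∃ z, E z ≠ ⊤ ∧
      (E z).toReal + c * dist (u t) z - lam / 2 * dist (u t) z ^ 2 < (E (u t)).toReal) :
    (E (u b)).toReal + c ^ 2 * (b - a) ≤ (E (u a)).toReal := by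
  set φ : ℝ → ℝ := fun t => (E (u t)).toReal with hφ
  have hφac : AbsolutelyContinuousOnInterval φ a b := hu.absolutelyContinuous_toReal hE ha hab
  have hanti : AntitoneOn φ (Ioi 0) := hu.toReal_antitoneOn hE
  have hid : AbsolutelyContinuousOnInterval (fun t : ℝ => t) a b :=
    LipschitzWith.id.lipschitzOnWith.absolutelyContinuousOnInterval
  have hF := (hφac.fun_add (hid.const_mul (c ^ 2))).le_of_ae_deriv_nonpos hab ?_
  · change φ b + c ^ 2 * (b - a) ≤ φ a
    linarith
  filter_upwards [hφac.ae_differentiableAt] with t ht hmem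
  have htpos : 0 < t := ha.trans hmem.1
  have hD := (ht (by rw [uIcc_of_le hab]; exact Ioo_subset_Icc_self hmem)).hasDerivAt
  set D := deriv φ t
  refine ⟨_, hD.add ((hasDerivAt_id' t).const_mul (c ^ 2)), ?_⟩
  rw [mul_one]
  by_contra! hpos
  have hslope := (hasDerivAt_iff_tendsto_slope.1 hD).mono_left (nhdsGT_le_nhdsNE t)
  have hD0 : D ≤ 0 := by
    refine le_of_tendsto hslope ?_
    filter_upwards [self_mem_nhdsWithin] with s hs
    have hs : t < s := hs
    rw [slope_def_field]
    exact div_nonpos_of_nonpos_of_nonneg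
      (sub_nonpos.2 (hanti htpos (show (0 : ℝ) < s from htpos.trans hs) hs.le)) (sub_nonneg.2 hs.le)
  -- If the dissipation rate `-D` is below `K < c ^ 2`, the EVI tested at `u t` bounds `dist (u s)
  -- (u t) ^ 2` by about `K * (s - t) ^ 2`. The right speed is then at most `c`, against steepness.
  obtain ⟨K, hDK, hKc⟩ := exists_between (show -D < c ^ 2 by linarith)
  have hK0 : 0 ≤ K := by linarith
  have hnear : ∀ᶠ r in 𝓝[>] t, φ t ≤ φ r + K * (r - t) := by
    filter_upwards [hslope.eventually (lt_mem_nhds (show -K < D by linarith)),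
      self_mem_nhdsWithin] with r hr htr
    have htr : 0 < r - t := sub_pos.2 htr
    rw [slope_def_field, lt_div_iff₀ htr] at hr
    linarith
  obtain ⟨η, hη, hsub⟩ := mem_nhdsGT_iff_exists_Ioo_subset.1 hnear
  have hexp : Tendsto (fun s => Real.exp (|lam| * (s - t)) * K) (𝓝[>] t) (𝓝 K) := by
    have : ContinuousAt (fun s => Real.exp (|lam| * (s - t)) * K) t := by fun_prop
    have h := this.tendsto.mono_left (nhdsWithin_le_nhds (s := Ioi t))
    simpa using h
  have hspeed : ∀ᶠ s in 𝓝[>] t, dist (u s) (u t) ≤ c * (s - t) := by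
    filter_upwards [hexp.eventually (gt_mem_nhds hKc), Ioo_mem_nhdsGT hη] with s hs hsη
    have hts : 0 < s - t := sub_pos.2 hsη.1
    have h1 := hu.integral_le_toReal hE htpos hsη.1.le (hu.ne_top hE htpos)
      (g := fun r => K * (r - t)) (by fun_prop)
      fun r hr => hsub ⟨hr.1, hr.2.trans hsη.2⟩
    rw [dist_self] at h1
    have h2 : ∫ r in t..s, Real.exp (lam * r) * (K * (r - t))
        ≤ ∫ r in t..s, Real.exp (lam * s) * (Real.exp (|lam| * (s - t)) * K) * (r - t) := by
      refine intervalIntegral.integral_mono_on hsη.1.le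
        (Continuous.intervalIntegrable (by fun_prop) _ _)
        (Continuous.intervalIntegrable (by fun_prop) _ _) fun r hr => ?_
      have h3 : Real.exp (lam * r) ≤ Real.exp (lam * s) * Real.exp (|lam| * (s - t)) := by
        rw [← Real.exp_add, Real.exp_le_exp]
        have h4 : -lam * (s - r) ≤ |lam| * (s - r) :=
          mul_le_mul_of_nonneg_right (neg_le_abs lam) (sub_nonneg.2 hr.2)
        have h5 : |lam| * (s - r) ≤ |lam| * (s - t) :=
          mul_le_mul_of_nonneg_left (by linarith [hr.1]) (abs_nonneg _)
        linarith
      have h6 : 0 ≤ K * (r - t) := mul_nonneg hK0 (sub_nonneg.2 hr.1)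
      have h7 := mul_le_mul_of_nonneg_right h3 h6
      linarith
    have h8 : ∫ r in t..s, (r - t) = (s - t) ^ 2 / 2 := by
      rw [intervalIntegral.integral_comp_sub_right (fun r => r), integral_id]
      ring
    rw [intervalIntegral.integral_const_mul, h8] at h2
    have hes := Real.exp_pos (lam * s)
    have h9 : dist (u s) (u t) ^ 2 ≤ Real.exp (|lam| * (s - t)) * K * (s - t) ^ 2 := by
      have : Real.exp (lam * s) * dist (u s) (u t) ^ 2
          ≤ Real.exp (lam * s) * (Real.exp (|lam| * (s - t)) * K * (s - t) ^ 2) := by linarith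
      exact le_of_mul_le_mul_left this hes
    refine (pow_le_pow_iff_left₀ dist_nonneg (by positivity) two_ne_zero).1 ?_
    rw [mul_pow]
    exact h9.trans (mul_le_mul_of_nonneg_right hs.le (sq_nonneg _))
  obtain ⟨z, hz, hlt⟩ := hsteep t hmem
  exact absurd (hu.toReal_le_of_right_speed_le hE htpos hspeed hz) (not_le.2 hlt)

end IsEVIFlow

/-! ### The descending slope and steepness with a quadratic correction. -/

section Slope

variable {X : Type*} [MetricSpace X] {E : X → EReal} {lam : ℝ}

theorem EVISetting.descendingSlope_ne_top (hE : EVISetting E lam) {x : X} {L : ℝ} (hx : E x ≠ ⊤)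
    (hL : ∀ z, E z ≠ ⊤ →
      (E x).toReal ≤ (E z).toReal + L * dist x z - lam / 2 * dist x z ^ 2) :
    descendingSlope E x ≠ ⊤ := by
  -- The extra `1` absorbs the quadratic term, which is negligible near `x`.
  have hle : descendingSlope E x ≤ ENNReal.ofReal (L + 1) := by
    rw [descendingSlope, if_neg hx]
    refine limsup_le_of_le (by isBoundedDefault) ?_
    have hnear : ∀ᶠ z in 𝓝[≠] x, |lam| / 2 * dist x z < 1 := by
      have : ContinuousAt (fun z => |lam| / 2 * dist x z) x := by fun_prop
      refine (this.tendsto.mono_left nhdsWithin_le_nhds).eventually (gt_mem_nhds ?_)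
      simp
    filter_upwards [hnear, self_mem_nhdsWithin] with z hz hne
    have hd : 0 < dist x z := dist_pos.2 (Ne.symm hne)
    refine ENNReal.div_le_of_le_mul ?_
    by_cases hzt : E z = ⊤
    · simp [hzt]
    rw [edist_dist, ← ENNReal.ofReal_mul' hd.le, ← hE.coe_toReal hx, ← hE.coe_toReal hzt,
      ← EReal.coe_sub, EReal.toENNReal_of_ne_top (EReal.coe_ne_top _), EReal.toReal_coe]
    refine ENNReal.ofReal_le_ofReal ?_
    have h1 := hL z hzt
    have h2 : -(lam / 2) * dist x z ^ 2 ≤ |lam| / 2 * dist x z ^ 2 :=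
      mul_le_mul_of_nonneg_right (by linarith [neg_le_abs lam]) (sq_nonneg _)
    nlinarith
  exact ne_top_of_le_ne_top ENNReal.ofReal_ne_top hle

/-- A lower bound of the slope at `x` persists, in a quantitative form, near `x`. -/
theorem EVISetting.exists_steep_of_lt_descendingSlope (hE : EVISetting E lam) {x : X} {c : ℝ}
    (hx : E x ≠ ⊤) (hc : ENNReal.ofReal c < descendingSlope E x) :
    ∃ z, E z ≠ ⊤ ∧ ∀ᶠ y in 𝓝 x,
      (((E z).toReal + c * dist y z - lam / 2 * dist y z ^ 2 : ℝ) : EReal) < E y := by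
  rw [descendingSlope, if_neg hx] at hc
  -- The gap `c' - c` pays for the quadratic correction once `z` is close enough to `x`.
  obtain ⟨c', hcc', hc'⟩ := ENNReal.lt_iff_exists_nnreal_btwn.1 hc
  have hcc : c < c' := by
    rw [← ENNReal.ofReal_coe_nnreal] at hcc'
    exact (ENNReal.ofReal_lt_ofReal_iff'.1 hcc').1
  have hnear : ∀ᶠ z in 𝓝[≠] x, |lam| / 2 * dist x z < c' - c := by
    have : ContinuousAt (fun z => |lam| / 2 * dist x z) x := by fun_prop
    refine (this.tendsto.mono_left nhdsWithin_le_nhds).eventually (gt_mem_nhds ?_)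
    simpa using hcc
  obtain ⟨z, hz, hzn, hne⟩ := ((frequently_lt_of_lt_limsup (by isBoundedDefault) hc').and_eventually
    (hnear.and self_mem_nhdsWithin)).exists
  have hd : 0 < dist x z := dist_pos.2 (Ne.symm hne)
  have hzt : E z ≠ ⊤ := by
    intro h
    simp [h] at hz
  refine ⟨z, hzt, ?_⟩
  have hlt : (E z).toReal + c * dist x z - lam / 2 * dist x z ^ 2 < (E x).toReal := by
    rw [ENNReal.lt_div_iff_mul_lt (Or.inl (edist_pos.2 (Ne.symm hne)).ne')
      (Or.inl (edist_ne_top _ _)), edist_dist, ← ENNReal.ofReal_coe_nnreal,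
      ← ENNReal.ofReal_mul' hd.le, ← hE.coe_toReal hx, ← hE.coe_toReal hzt, ← EReal.coe_sub,
      EReal.toENNReal_of_ne_top (EReal.coe_ne_top _), EReal.toReal_coe] at hz
    have h1 := (ENNReal.ofReal_lt_ofReal_iff'.1 hz).1
    have h2 : -(lam / 2) * dist x z ^ 2 ≤ |lam| / 2 * dist x z ^ 2 :=
      mul_le_mul_of_nonneg_right (by linarith [neg_le_abs lam]) (sq_nonneg _)
    nlinarith
  obtain ⟨m, hm1, hm2⟩ := exists_between hlt
  have hcont : ContinuousAt
      (fun y => (E z).toReal + c * dist y z - lam / 2 * dist y z ^ 2) x := by fun_prop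
  have hmE : (m : EReal) < E x := by
    rw [← hE.coe_toReal hx]
    exact EReal.coe_lt_coe_iff.2 hm2
  filter_upwards [hcont.tendsto.eventually (gt_mem_nhds hm1), hE.lsc x _ hmE] with y h1 h2
  exact (EReal.coe_lt_coe_iff.2 h1).trans h2

end Slope

/-! ### Estimates down to time zero, and bounds uniform in the starting point. -/

namespace IsEVIFlowFrom

variable {X : Type*} [MetricSpace X] {E : X → EReal} {lam : ℝ} {u v : ℝ → X} {x y : X}

theorem dist_le (hu : IsEVIFlowFrom E lam u x) (hv : IsEVIFlowFrom E lam v y)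
    (hE : EVISetting E lam) {t : ℝ} (ht : 0 < t) :
    Real.exp (lam * t) * dist (u t) (v t) ≤ dist x y := by
  have hexp : Tendsto (fun s => Real.exp (lam * s)) (𝓝[>] 0) (𝓝 1) := by
    have : ContinuousAt (fun s => Real.exp (lam * s)) 0 := by fun_prop
    simpa using this.tendsto.mono_left (nhdsWithin_le_nhds (s := Ioi 0))
  have hlim := hexp.mul (hu.tendsto_start.dist hv.tendsto_start)
  rw [one_mul] at hlim
  refine ge_of_tendsto hlim ?_
  filter_upwards [Ioo_mem_nhdsGT ht] with s hs
  exact hu.flow.contraction hv.flow hE hs.1 hs.2.le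

/-- The limit `s → 0` of the EVI on `[s, t]`, with the squared distance at time `t` discarded. The
starting point itself may have infinite energy. -/
theorem toReal_le (hu : IsEVIFlowFrom E lam u x) (hE : EVISetting E lam) {t : ℝ} (ht : 0 < t)
    (hy : E y ≠ ⊤) :
    (E (u t)).toReal ≤ (E y).toReal + dist x y ^ 2 / 2 / ∫ r in (0 : ℝ)..t, Real.exp (lam * r) := by
  have hcont : Continuous fun s : ℝ => ∫ r in (0 : ℝ)..s, Real.exp (lam * r) :=
    continuous_iff_continuousAt.2 fun s => (hasDerivAt_integral_exp lam 0 s).continuousAt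
  have hint : ∀ s, ∫ r in s..t, Real.exp (lam * r) = (∫ r in (0 : ℝ)..t, Real.exp (lam * r))
      - ∫ r in (0 : ℝ)..s, Real.exp (lam * r) := fun s =>
    (intervalIntegral.integral_interval_sub_left (Continuous.intervalIntegrable (by fun_prop) _ _)
      (Continuous.intervalIntegrable (by fun_prop) _ _)).symm
  have hlim1 : Tendsto (fun s => ((E (u t)).toReal - (E y).toReal) *
      ∫ r in s..t, Real.exp (lam * r)) (𝓝[>] 0)
      (𝓝 (((E (u t)).toReal - (E y).toReal) * ∫ r in (0 : ℝ)..t, Real.exp (lam * r))) := by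
    have h0 := (hcont.tendsto 0).mono_left (nhdsWithin_le_nhds (s := Ioi 0))
    rw [intervalIntegral.integral_same] at h0
    have h1 := (h0.const_sub (∫ r in (0 : ℝ)..t, Real.exp (lam * r))).const_mul
      ((E (u t)).toReal - (E y).toReal)
    rw [sub_zero] at h1
    exact h1.congr fun s => by rw [hint s]
  have hexp : Tendsto (fun s => Real.exp (lam * s) / 2) (𝓝[>] 0) (𝓝 (1 / 2)) := by
    have : ContinuousAt (fun s => Real.exp (lam * s) / 2) 0 := by fun_prop
    simpa using this.tendsto.mono_left (nhdsWithin_le_nhds (s := Ioi 0))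
  have hlim2 := hexp.mul ((hu.tendsto_start.dist (tendsto_const_nhds (x := y))).pow 2)
  rw [← sub_le_iff_le_add', le_div_iff₀ (integral_exp_pos lam ht)]
  refine (le_of_tendsto_of_tendsto hlim1 hlim2 ?_).trans (by linarith)
  filter_upwards [Ioo_mem_nhdsGT ht] with s hs
  have h := hu.flow.evi_toReal hE hs.1 hs.2.le hy
  have h0 : 0 ≤ Real.exp (lam * t) / 2 * dist (u t) y ^ 2 := by positivity
  linarith

end IsEVIFlowFrom

section UniformBounds

variable {X : Type*} [MetricSpace X] {E : X → EReal} {lam : ℝ}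

/-- The regularizing estimate bounds the energy at `a` from above. By contraction the points reached
at `C` stay in one ball, on which `E` is bounded below. -/
theorem EVISetting.exists_energy_bound (hE : EVISetting E lam) {B : Set X}
    (hB : Bornology.IsBounded B) {a C : ℝ} (ha : 0 < a) (haC : a ≤ C) :
    ∃ M : ℝ, ∀ x ∈ B, ∀ u, IsEVIFlowFrom E lam u x →
      (E (u a)).toReal - (E (u C)).toReal ≤ M := by
  rcases B.eq_empty_or_nonempty with rfl | ⟨x₀, -⟩
  · exact ⟨0, fun x hx => absurd hx (notMem_empty x)⟩
  have : Nonempty X := ⟨x₀⟩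
  obtain ⟨y, hy⟩ := hE.dense_domain.nonempty
  obtain ⟨v, hv⟩ := hE.exists_flow y
  obtain ⟨R, hR⟩ := hB.subset_closedBall y
  obtain ⟨m, hm⟩ := hE.bddBelow _ (Metric.isBounded_closedBall (x := v C)
    (r := R / Real.exp (lam * C)))
  have hI := integral_exp_pos lam ha
  refine ⟨(E y).toReal + R ^ 2 / 2 / (∫ r in (0 : ℝ)..a, Real.exp (lam * r)) - m,
    fun x hx u hu => ?_⟩
  have hC : 0 < C := ha.trans_le haC
  have hdR : dist x y ≤ R := hR hx
  have h1 := hu.toReal_le hE ha hy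
  have h2 : dist x y ^ 2 / 2 / (∫ r in (0 : ℝ)..a, Real.exp (lam * r))
      ≤ R ^ 2 / 2 / (∫ r in (0 : ℝ)..a, Real.exp (lam * r)) := by gcongr
  have h3 : (m : EReal) ≤ E (u C) := by
    refine hm _ ?_
    rw [Metric.mem_closedBall, le_div_iff₀ (Real.exp_pos _), mul_comm]
    exact (hu.dist_le hv hE hC).trans hdR
  rw [← hE.coe_toReal (hu.flow.ne_top hE hC), EReal.coe_le_coe_iff] at h3
  linarith

theorem EVISetting.exists_uniform_lipschitz (hE : EVISetting E lam) {B : Set X}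
    (hB : Bornology.IsBounded B) {c C : ℝ} (hc : 0 < c) (hcC : c ≤ C) :
    ∃ L : ℝ, 0 ≤ L ∧ ∀ x ∈ B, ∀ u, IsEVIFlowFrom E lam u x →
      ∀ s ∈ Icc c C, ∀ t ∈ Icc c C, dist (u s) (u t) ≤ L * |s - t| := by
  obtain ⟨M, hM⟩ := hE.exists_energy_bound hB (half_pos hc) (show c / 2 ≤ C by linarith)
  exact ⟨_, Real.sqrt_nonneg _, fun x hx u hu s hs t ht =>
    hu.flow.dist_le_of_energy_osc hE (half_pos hc) (half_lt_self hc) (hM x hx u hu) hs ht⟩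

end UniformBounds

/-! ### The regularized curve: absolute continuity and the pointwise inequality. -/

section FlowFamily

variable {X : Type*} [MetricSpace X] {E : X → EReal} {lam : ℝ}

theorem EVISetting.exists_flow_family (hE : EVISetting E lam) :
    ∃ u : X → ℝ → X, (∀ x, IsEVIFlowFrom E lam (u x) x) ∧
      ∀ x t, 0 < t → eviSemigroup E lam t x = u x t := by
  refine ⟨fun x => (hE.exists_flow x).choose, fun x => (hE.exists_flow x).choose_spec,
    fun x t ht => ?_⟩
  rw [eviSemigroup, dif_pos (hE.exists_flow x), if_pos ht]

variable {u : X → ℝ → X}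

theorem EVISetting.dist_flow_le (hE : EVISetting E lam) (hu : ∀ x, IsEVIFlowFrom E lam (u x) x)
    (x y : X) {t : ℝ} (ht : 0 < t) :
    dist (u x t) (u y t) ≤ Real.exp (-(lam * t)) * dist x y := by
  have h := (hu x).dist_le (hu y) hE ht
  rw [Real.exp_neg, ← div_eq_inv_mul, le_div_iff₀ (Real.exp_pos _), mul_comm]
  exact h

theorem EVISetting.tendsto_flow (hE : EVISetting E lam) (hu : ∀ x, IsEVIFlowFrom E lam (u x) x)
    (x : X) {t : ℝ} (ht : 0 < t) :
    Tendsto (fun p : X × ℝ => u p.1 p.2) (𝓝 x ×ˢ 𝓝 t) (𝓝 (u x t)) := by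
  refine tendsto_iff_dist_tendsto_zero.2 ?_
  have h1 : Tendsto (fun p : X × ℝ => Real.exp (-(lam * p.2)) * dist p.1 x
      + dist (u x p.2) (u x t)) (𝓝 x ×ˢ 𝓝 t) (𝓝 0) := by
    have hexp : Tendsto (fun p : X × ℝ => Real.exp (-(lam * p.2))) (𝓝 x ×ˢ 𝓝 t)
        (𝓝 (Real.exp (-(lam * t)))) := by
      have : ContinuousAt (fun q : ℝ => Real.exp (-(lam * q))) t := by fun_prop
      exact this.tendsto.comp tendsto_snd
    have hd : Tendsto (fun p : X × ℝ => dist p.1 x) (𝓝 x ×ˢ 𝓝 t) (𝓝 0) :=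
      (tendsto_iff_dist_tendsto_zero.1 tendsto_id).comp tendsto_fst
    have hc : Tendsto (fun p : X × ℝ => dist (u x p.2) (u x t)) (𝓝 x ×ˢ 𝓝 t) (𝓝 0) :=
      (tendsto_iff_dist_tendsto_zero.1 ((hu x).flow.continuousAt ht)).comp tendsto_snd
    simpa using (hexp.mul hd).add hc
  refine squeeze_zero' (Eventually.of_forall fun _ => dist_nonneg) ?_ h1
  filter_upwards [tendsto_snd.eventually (lt_mem_nhds ht)] with p hp
  refine (dist_triangle _ (u x p.2) _).trans ?_
  gcongr
  exact hE.dist_flow_le hu _ _ hp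

/-- Compactness keeps `h` in an interval away from `0` and `γ` in a bounded set, so one `L` serves
as Lipschitz constant in time and as slope bound along `Γ`. Contraction handles the change of
starting point. -/
theorem EVISetting.regularized_curve (hE : EVISetting E lam)
    (hu : ∀ x, IsEVIFlowFrom E lam (u x) x) {γ Γ : ℝ → X} {h : ℝ → ℝ} {a b : ℝ} (hab : a ≤ b)
    (hγ : AbsolutelyContinuousOnInterval γ a b) (hh : AbsolutelyContinuousOnInterval h a b)
    (hpos : ∀ t ∈ Icc a b, 0 < h t) (hΓ : ∀ t ∈ Icc a b, Γ t = u (γ t) (h t)) :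
    AbsolutelyContinuousOnInterval Γ a b ∧
      AbsolutelyContinuousOnInterval (fun t => (E (Γ t)).toReal) a b ∧
      ∀ t ∈ Icc a b, descendingSlope E (Γ t) ≠ ⊤ := by
  have hγc := hγ.continuousOn_of_metric
  have hhc := hh.continuousOn
  rw [uIcc_of_le hab] at hγc hhc
  have hne : (Icc a b).Nonempty := nonempty_Icc.2 hab
  obtain ⟨p, hp, hmin⟩ := isCompact_Icc.exists_isMinOn hne hhc
  obtain ⟨q, hq, hmax⟩ := isCompact_Icc.exists_isMaxOn hne hhc
  have hc : 0 < h p := hpos p hp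
  have hpq : h p ≤ h q := hmin hq
  have hmem : ∀ t ∈ Icc a b, h t ∈ Ico (h p) (h q + 1) := fun t ht =>
    ⟨hmin ht, lt_of_le_of_lt (hmax ht) (lt_add_one _)⟩
  obtain ⟨L, hL0, hL⟩ := hE.exists_uniform_lipschitz
    (isCompact_Icc.image_of_continuousOn hγc).isBounded hc (show h p ≤ h q + 1 by linarith)
  have hslope : ∀ t ∈ Icc a b, ∀ z, E z ≠ ⊤ →
      (E (Γ t)).toReal ≤ (E z).toReal + L * dist (Γ t) z - lam / 2 * dist (Γ t) z ^ 2 := by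
    intro t ht z hz
    rw [hΓ t ht]
    exact (hu (γ t)).flow.toReal_le_of_lipschitz hE hc
      (hL _ (mem_image_of_mem γ ht) _ (hu _)) (hmem t ht) hz
  have htop : ∀ t ∈ Icc a b, E (Γ t) ≠ ⊤ := fun t ht => by
    rw [hΓ t ht]; exact (hu (γ t)).flow.ne_top hE (hpos t ht)
  have hΓac : AbsolutelyContinuousOnInterval Γ a b := by
    refine .of_dist_le (Real.exp (|lam| * (h q + 1))) L hγ hh fun s hs t ht => ?_
    rw [uIcc_of_le hab] at hs ht
    rw [hΓ s hs, hΓ t ht]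
    refine (dist_triangle _ (u (γ t) (h s)) _).trans (add_le_add ?_ ?_)
    · refine (hE.dist_flow_le hu _ _ (hpos s hs)).trans ?_
      gcongr
      rw [← neg_mul, ← abs_neg lam]
      have h1 := exp_mul_le_exp_abs_mul (lam := -lam) (hpos s hs).le (hmem s hs).2.le
      exact Real.exp_le_exp.1 h1
    · exact hL _ (mem_image_of_mem γ ht) _ (hu _) _ (Ico_subset_Icc_self (hmem s hs)) _
        (Ico_subset_Icc_self (hmem t ht))
  refine ⟨hΓac, ?_, fun t ht => hE.descendingSlope_ne_top (htop t ht) (hslope t ht)⟩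
  have hΓc := hΓac.continuousOn_of_metric
  rw [uIcc_of_le hab] at hΓc
  have hbdd := (isCompact_Icc.image_of_continuousOn hΓc).isBounded
  set R := Metric.diam (Γ '' Icc a b) with hR
  have key : ∀ s ∈ Icc a b, ∀ t ∈ Icc a b, (E (Γ t)).toReal - (E (Γ s)).toReal
      ≤ (L + |lam| / 2 * R) * dist (Γ s) (Γ t) := by
    intro s hs t ht
    have h1 := hslope t ht (Γ s) (htop s hs)
    rw [dist_comm] at h1
    have h2 : dist (Γ s) (Γ t) ≤ R :=
      Metric.dist_le_diam_of_mem hbdd (mem_image_of_mem Γ hs) (mem_image_of_mem Γ ht)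
    set d := dist (Γ s) (Γ t)
    have hd0 : 0 ≤ d := dist_nonneg
    have h5 : -(lam / 2) * d ^ 2 ≤ |lam| / 2 * d ^ 2 :=
      mul_le_mul_of_nonneg_right (by linarith [neg_le_abs lam]) (sq_nonneg d)
    have h6 : |lam| / 2 * (d * d) ≤ |lam| / 2 * (R * d) := by gcongr
    linarith
  refine .of_dist_le (L + |lam| / 2 * R) 0 hΓac hΓac fun s hs t ht => ?_
  rw [uIcc_of_le hab] at hs ht
  rw [zero_mul, add_zero, Real.dist_eq, abs_le]
  have h1 := key s hs t ht
  have h2 := key t ht s hs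
  rw [dist_comm] at h2
  constructor <;> linarith

theorem EVISetting.eventually_dissipation (hE : EVISetting E lam)
    (hu : ∀ x, IsEVIFlowFrom E lam (u x) x) {γ : ℝ → X} {h : ℝ → ℝ} {t c : ℝ}
    (hγ : ContinuousAt γ t) (hh : ContinuousAt h t) (hpos : 0 < h t) (hc0 : 0 ≤ c)
    (hc : ENNReal.ofReal c < descendingSlope E (u (γ t) (h t))) :
    ∀ᶠ s in 𝓝 t, ∀ r ∈ Ioo (h t) (h s),
      (E (u (γ s) (h s))).toReal + c ^ 2 * (h s - r) ≤ (E (u (γ s) r)).toReal := by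
  obtain ⟨z, hz, hsteep⟩ :=
    hE.exists_steep_of_lt_descendingSlope ((hu (γ t)).flow.ne_top hE hpos) hc
  -- Joint continuity of the flow keeps `u (γ s) q` in the steep neighbourhood for every `q` between
  -- `h t` and `h s`.
  obtain ⟨P, hP, Q, hQ, hPQ⟩ :=
    eventually_prod_iff.1 ((hE.tendsto_flow hu (γ t) hpos).eventually hsteep)
  obtain ⟨η, hη, hball⟩ := Metric.eventually_nhds_iff.1 hQ
  filter_upwards [hγ.eventually hP, hh.eventually (gt_mem_nhds (lt_add_of_pos_right _ hη))]
    with s hPs hhs r hr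
  refine (hu (γ s)).flow.energy_dissipation hE (hpos.trans hr.1) hr.2.le hc0 fun q hq => ?_
  have hq0 : h t < q := hr.1.trans hq.1
  have hQq : Q q := hball (by
    rw [Real.dist_eq, abs_of_pos (sub_pos.2 hq0)]
    linarith [hq.2])
  have h1 := hPQ hPs hQq
  simp only at h1
  rw [← hE.coe_toReal ((hu (γ s)).flow.ne_top hE (hpos.trans hq0)), EReal.coe_lt_coe_iff] at h1
  exact ⟨z, hz, h1⟩

/-- Only the `κ`-term has its weight replaced by a lower bound; `A` may have either sign and keeps
the exact integral. -/
theorem integral_exp_mul_sub_le {lam κ a b : ℝ} (hκ : 0 ≤ κ) (hab : a ≤ b) (A : ℝ) :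
    ∫ r in a..b, Real.exp (lam * r) * (A - κ * (b - r)) ≤
      A * (∫ r in a..b, Real.exp (lam * r))
        - κ * (Real.exp (lam * a) * Real.exp (-(|lam| * (b - a)))) * ((b - a) ^ 2 / 2) := by
  set m := Real.exp (lam * a) * Real.exp (-(|lam| * (b - a))) with hm
  have h1 : ∫ r in a..b, Real.exp (lam * r) * (A - κ * (b - r))
      ≤ ∫ r in a..b, (A * Real.exp (lam * r) - κ * m * (b - r)) := by
    refine intervalIntegral.integral_mono_on hab
      (Continuous.intervalIntegrable (by fun_prop) _ _)
      (Continuous.intervalIntegrable (by fun_prop) _ _) fun r hr => ?_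
    have h2 : m ≤ Real.exp (lam * r) := by
      rw [hm, ← Real.exp_add, Real.exp_le_exp]
      have h3 : -|lam| * (r - a) ≤ lam * (r - a) :=
        mul_le_mul_of_nonneg_right (neg_abs_le lam) (sub_nonneg.2 hr.1)
      have h4 : |lam| * (r - a) ≤ |lam| * (b - a) :=
        mul_le_mul_of_nonneg_left (by linarith [hr.2]) (abs_nonneg _)
      linarith
    have h5 := mul_le_mul_of_nonneg_right h2 (mul_nonneg hκ (sub_nonneg.2 hr.2))
    linarith
  have h6 : ∫ r in a..b, (b - r) = (b - a) ^ 2 / 2 := by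
    rw [intervalIntegral.integral_comp_sub_left (fun r => r), integral_id]
    ring
  rw [intervalIntegral.integral_sub (Continuous.intervalIntegrable (by fun_prop) _ _)
    (Continuous.intervalIntegrable (by fun_prop) _ _), intervalIntegral.integral_const_mul,
    intervalIntegral.integral_const_mul, h6] at h1
  exact h1

theorem EVISetting.speed_ineq (hE : EVISetting E lam)
    (hu : ∀ x, IsEVIFlowFrom E lam (u x) x) {γ Γ : ℝ → X} {h : ℝ → ℝ} {t v w dh de κ : ℝ}
    {l : Filter ℝ} [l.NeBot] (hl : l ≤ 𝓝[≠] t) (hv : HasMetricSpeedAt γ v t)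
    (hw : HasMetricSpeedAt Γ w t) (hdh : HasDerivAt h dh t)
    (hde : HasDerivAt (fun s => (E (Γ s)).toReal) de t) (hpos : 0 < h t)
    (hΓt : Γ t = u (γ t) (h t)) (hΓ : ∀ᶠ s in l, Γ s = u (γ s) (h s))
    (hlt : ∀ᶠ s in l, h t < h s) (hκ : 0 ≤ κ)
    (hdis : ∀ᶠ s in l, ∀ r ∈ Ioo (h t) (h s),
      (E (u (γ s) (h s))).toReal + κ * (h s - r) ≤ (E (u (γ s) r)).toReal) :
    1 / 2 * w ^ 2 + 1 / 2 * dh ^ 2 * κ + dh * de ≤ 1 / 2 * Real.exp (-2 * lam * h t) * v ^ 2 := by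
  set e : ℝ → ℝ := fun s => (E (Γ s)).toReal with he
  have hJ : HasDerivAt (fun s => ∫ r in h t..h s, Real.exp (lam * r))
      (Real.exp (lam * h t) * dh) t :=
    HasDerivAt.comp (h₂ := fun x => ∫ r in h t..x, Real.exp (lam * r)) t
      (hasDerivAt_integral_exp lam (h t) (h t)) hdh
  have hJs := (hasDerivAt_iff_tendsto_slope.1 hJ).mono_left hl
  have hes := (hasDerivAt_iff_tendsto_slope.1 hde).mono_left hl
  have hhs := (hasDerivAt_iff_tendsto_slope.1 hdh).mono_left hl
  have hhc : Tendsto h l (𝓝 (h t)) := hdh.continuousAt.tendsto.mono_left (hl.trans nhdsWithin_le_nhds)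
  have hE1 : Tendsto (fun s => Real.exp (lam * h s) / 2) l (𝓝 (Real.exp (lam * h t) / 2)) := by
    have : ContinuousAt (fun x => Real.exp (lam * x) / 2) (h t) := by fun_prop
    exact this.tendsto.comp hhc
  have hE2 : Tendsto (fun s => κ * (Real.exp (lam * h t) * Real.exp (-(|lam| * (h s - h t)))) / 2) l
      (𝓝 (κ * (Real.exp (lam * h t) * 1) / 2)) := by
    have : ContinuousAt
      (fun x => κ * (Real.exp (lam * h t) * Real.exp (-(|lam| * (x - h t)))) / 2) (h t) := by
      fun_prop
    have h1 := this.tendsto.comp hhc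
    simpa using! h1
  have hlhs := (hE1.mul ((hw.mono_left hl).pow 2)).sub
    (((hv.mono_left hl).pow 2).const_mul (Real.exp (-(lam * h t)) / 2))
  have hrhs := ((hes.neg).mul hJs).sub (hE2.mul (hhs.pow 2))
  have hlim := le_of_tendsto_of_tendsto hlhs hrhs ?_
  · have h1 : Real.exp (-2 * lam * h t) = Real.exp (-(lam * h t)) * Real.exp (-(lam * h t)) := by
      rw [← Real.exp_add]; congr 1; ring
    have h2 : Real.exp (-(lam * h t)) * Real.exp (lam * h t) = 1 := by
      rw [← Real.exp_add]; simp
    have h3 := mul_le_mul_of_nonneg_left hlim (Real.exp_pos (-(lam * h t))).le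
    rw [h1]
    set p := Real.exp (-(lam * h t))
    set q := Real.exp (lam * h t)
    have h4 : p * (q / 2 * w ^ 2 - p / 2 * v ^ 2) = (p * q) * w ^ 2 / 2 - p * p * v ^ 2 / 2 := by
      ring
    have h5 : p * (-de * (q * dh) - κ * (q * 1) / 2 * dh ^ 2)
        = (p * q) * (-de * dh - κ * dh ^ 2 / 2) := by ring
    rw [h4, h5, h2] at h3
    linarith
  · have hne : ∀ᶠ s in l, s ≠ t := hl self_mem_nhdsWithin
    filter_upwards [hΓ, hlt, hdis, hne] with s hΓs hlts hdiss hnes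
    have hst : s - t ≠ 0 := sub_ne_zero.2 hnes
    have hst2 : 0 < (s - t) ^ 2 := by positivity
    -- The EVI for the flow from `γ s` on `[h t, h s]`, tested at `Γ t`, with the dissipation bound
    -- in the integrand.
    have hg := (hu (γ s)).flow.integral_le_toReal hE hpos hlts.le
      ((hu (γ t)).flow.ne_top hE hpos) (g := fun r => (e t - e s) - κ * (h s - r)) (by fun_prop)
      (fun r hr => by
        have := hdiss r hr
        simp only [he, hΓs, hΓt]
        linarith)
    have hint := integral_exp_mul_sub_le (lam := lam) hκ hlts.le (e t - e s)
    have hcon : Real.exp (lam * h t) / 2 * dist (u (γ s) (h t)) (u (γ t) (h t)) ^ 2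
        ≤ Real.exp (-(lam * h t)) / 2 * dist (γ s) (γ t) ^ 2 := by
      have h1 := pow_le_pow_left₀ dist_nonneg (hE.dist_flow_le hu (γ s) (γ t) hpos) 2
      have h2 : Real.exp (lam * h t) * Real.exp (-(lam * h t)) = 1 := by
        rw [← Real.exp_add]; simp
      have h3 := mul_le_mul_of_nonneg_left h1 (show 0 ≤ Real.exp (lam * h t) / 2 by positivity)
      refine h3.trans (le_of_eq ?_)
      linear_combination (Real.exp (-(lam * h t)) / 2 * dist (γ s) (γ t) ^ 2) * h2
    rw [← hΓs, ← hΓt] at hg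
    have hfinal : Real.exp (lam * h s) / 2 * dist (Γ s) (Γ t) ^ 2
        - Real.exp (-(lam * h t)) / 2 * dist (γ s) (γ t) ^ 2
        ≤ (e t - e s) * (∫ r in h t..h s, Real.exp (lam * r))
        - κ * (Real.exp (lam * h t) * Real.exp (-(|lam| * (h s - h t)))) * ((h s - h t) ^ 2 / 2) := by
      rw [← hΓt] at hcon
      linarith
    have h7 := div_le_div_of_nonneg_right hfinal hst2.le
    rw [slope_def_field, slope_def_field, slope_def_field, intervalIntegral.integral_same, sub_zero,
      div_pow, div_pow, sq_abs]
    refine le_trans (le_of_eq ?_) (h7.trans (le_of_eq ?_))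
    · field_simp
    · field_simp
      ring

/-- Here possibly no side has `h s > h t`. The change of flow time costs `L * |h s - h t|`, which is
negligible relative to `|s - t|`, so only contraction contributes. -/
theorem EVISetting.speed_le_of_deriv_eq_zero (hE : EVISetting E lam)
    (hu : ∀ x, IsEVIFlowFrom E lam (u x) x) {γ Γ : ℝ → X} {h : ℝ → ℝ} {t v w : ℝ}
    (hv : HasMetricSpeedAt γ v t) (hw : HasMetricSpeedAt Γ w t) (hdh : HasDerivAt h 0 t)
    (hpos : 0 < h t) (hΓ : ∀ᶠ s in 𝓝 t, Γ s = u (γ s) (h s)) :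
    w ≤ Real.exp (-(lam * h t)) * v := by
  obtain ⟨L, -, hL⟩ := hE.exists_uniform_lipschitz (B := {γ t}) Bornology.isBounded_singleton
    (half_pos hpos) (show h t / 2 ≤ 2 * h t by linarith)
  have hL := hL (γ t) rfl _ (hu _)
  have hhc := hdh.continuousAt.tendsto
  have hexp : Tendsto (fun s => Real.exp (-(lam * h s))) (𝓝[≠] t) (𝓝 (Real.exp (-(lam * h t)))) := by
    have : ContinuousAt (fun x => Real.exp (-(lam * x))) (h t) := by fun_prop
    exact (this.tendsto.comp hhc).mono_left nhdsWithin_le_nhds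
  have hlim := (hexp.mul hv).add (hdh.tendsto_abs_div.const_mul L)
  rw [abs_zero, mul_zero, add_zero] at hlim
  refine le_of_tendsto_of_tendsto hw hlim ?_
  have hIcc : ∀ᶠ s in 𝓝 t, h s ∈ Icc (h t / 2) (2 * h t) :=
    hhc.eventually (Icc_mem_nhds (by linarith) (by linarith))
  have hΓt := hΓ.self_of_nhds
  filter_upwards [nhdsWithin_le_nhds hΓ, nhdsWithin_le_nhds hIcc] with s hs hsI
  rw [← mul_div_assoc, ← mul_div_assoc, ← add_div]
  refine div_le_div_of_nonneg_right ?_ (abs_nonneg _)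
  rw [hs, hΓt]
  refine (dist_triangle _ (u (γ t) (h s)) _).trans (add_le_add ?_ ?_)
  · exact hE.dist_flow_le hu _ _ (by linarith [hsI.1])
  · exact hL _ hsI _ ⟨by linarith, by linarith⟩

theorem EVISetting.regularized_ineq (hE : EVISetting E lam)
    (hu : ∀ x, IsEVIFlowFrom E lam (u x) x) {γ Γ : ℝ → X} {h : ℝ → ℝ} {t v w dh de : ℝ}
    (hγ : ContinuousAt γ t) (hv : HasMetricSpeedAt γ v t)
    (hw : HasMetricSpeedAt Γ w t) (hdh : HasDerivAt h dh t)
    (hde : HasDerivAt (fun s => (E (Γ s)).toReal) de t) (hpos : 0 < h t)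
    (hΓ : ∀ᶠ s in 𝓝 t, Γ s = u (γ s) (h s)) (hfin : descendingSlope E (Γ t) ≠ ⊤) :
    1 / 2 * w ^ 2 + 1 / 2 * |dh| ^ 2 * (descendingSlope E (Γ t)).toReal ^ 2 + dh * de
      ≤ 1 / 2 * Real.exp (-2 * lam * h t) * v ^ 2 := by
  have hΓt := hΓ.self_of_nhds
  rw [sq_abs]
  by_cases hd0 : dh = 0
  · subst hd0
    have h1 := hE.speed_le_of_deriv_eq_zero hu hv hw hdh hpos hΓ
    have hw0 : 0 ≤ w := ge_of_tendsto hw (Eventually.of_forall fun s => by positivity)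
    have h2 := pow_le_pow_left₀ hw0 h1 2
    have h3 : Real.exp (-2 * lam * h t) = Real.exp (-(lam * h t)) ^ 2 := by
      rw [← Real.exp_nat_mul]; congr 1; push_cast; ring
    rw [h3]
    rw [mul_pow] at h2
    linarith
  -- One-sided limits suffice, since all derivatives exist at `t`: the left side if `dh < 0`, the
  -- right side if `dh > 0`.
  obtain ⟨l, hlne, hl, hlt⟩ : ∃ l : Filter ℝ, l.NeBot ∧ l ≤ 𝓝[≠] t ∧ ∀ᶠ s in l, h t < h s := by
    have hslope := hasDerivAt_iff_tendsto_slope.1 hdh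
    rcases lt_or_gt_of_ne hd0 with hneg | hpos'
    · refine ⟨𝓝[<] t, inferInstance, nhdsLT_le_nhdsNE t, ?_⟩
      filter_upwards [(hslope.mono_left (nhdsLT_le_nhdsNE t)).eventually (gt_mem_nhds hneg),
        self_mem_nhdsWithin] with s hs hst
      rw [slope_def_field, div_lt_iff_of_neg (sub_neg.2 hst), zero_mul] at hs
      exact sub_pos.1 hs
    · refine ⟨𝓝[>] t, inferInstance, nhdsGT_le_nhdsNE t, ?_⟩
      filter_upwards [(hslope.mono_left (nhdsGT_le_nhdsNE t)).eventually (lt_mem_nhds hpos'),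
        self_mem_nhdsWithin] with s hs hst
      rw [slope_def_field, lt_div_iff₀ (sub_pos.2 hst), zero_mul] at hs
      exact sub_pos.1 hs
  have hln : l ≤ 𝓝 t := hl.trans nhdsWithin_le_nhds
  set σ := (descendingSlope E (Γ t)).toReal with hσ
  -- For zero slope no `c` with `0 ≤ c < σ` exists, and monotonicity of the energy is dissipation at
  -- rate `0`.
  rcases (ENNReal.toReal_nonneg : 0 ≤ σ).eq_or_lt with h0 | hσpos
  · rw [hσ, ← h0]
    refine hE.speed_ineq hu hl hv hw hdh hde hpos hΓt (hln hΓ) hlt (sq_nonneg 0) ?_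
    refine Eventually.of_forall fun s r hr => ?_
    have := (hu (γ s)).flow.toReal_antitoneOn hE (show (0 : ℝ) < r from hpos.trans hr.1)
      (show (0 : ℝ) < h s from hpos.trans (hr.1.trans hr.2)) hr.2.le
    simpa using this
  · have hlim : Tendsto (fun c : ℝ => 1 / 2 * w ^ 2 + 1 / 2 * dh ^ 2 * c ^ 2 + dh * de) (𝓝[<] σ)
        (𝓝 (1 / 2 * w ^ 2 + 1 / 2 * dh ^ 2 * σ ^ 2 + dh * de)) := by
      have : ContinuousAt (fun c : ℝ => 1 / 2 * w ^ 2 + 1 / 2 * dh ^ 2 * c ^ 2 + dh * de) σ := by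
        fun_prop
      exact this.tendsto.mono_left nhdsWithin_le_nhds
    refine le_of_tendsto hlim ?_
    filter_upwards [Ioo_mem_nhdsLT hσpos] with c hc
    refine hE.speed_ineq hu hl hv hw hdh hde hpos hΓt (hln hΓ) hlt (sq_nonneg c) ?_
    refine hln (hE.eventually_dissipation hu hγ hdh.continuousAt hpos hc.1.le ?_)
    rw [← hΓt]
    exact (ENNReal.ofReal_lt_iff_lt_toReal hc.1.le hfin).2 hc.2

end FlowFamily

/-! ### The main theorem. -/

theorem proposition3p7 {X : Type*} [MetricSpace X] [CompleteSpace X]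
    [TopologicalSpace.SeparableSpace X] (E : X → EReal) (lam : ℝ) (hE : EVISetting E lam)
    (γ : ℝ → X) (hγ : AbsolutelyContinuousOnInterval γ 0 1)
    (h : ℝ → ℝ) (hh : AbsolutelyContinuousOnInterval h 0 1)
    (hpos : ∀ t ∈ Ioo (0 : ℝ) 1, 0 < h t)
    (γtilde : ℝ → X) (hγtilde : ∀ t ∈ Icc (0 : ℝ) 1, γtilde t = eviSemigroup E lam (h t) (γ t)) :
    (∀ t ∈ Ioo (0 : ℝ) 1, E (γtilde t) ≠ ⊤ ∧ descendingSlope E (γtilde t) ≠ ⊤) ∧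
    ∀ᵐ t : ℝ, t ∈ Ioo (0 : ℝ) 1 →
      ∃ speed speedTilde dh dE : ℝ,
        HasMetricSpeedAt γ speed t ∧
        HasMetricSpeedAt γtilde speedTilde t ∧
        HasDerivAt h dh t ∧
        HasDerivAt (fun s => (E (γtilde s)).toReal) dE t ∧
        1 / 2 * speedTilde ^ 2 + 1 / 2 * |dh| ^ 2 * (descendingSlope E (γtilde t)).toReal ^ 2 + dh * dE
          ≤ 1 / 2 * Real.exp (-2 * lam * h t) * speed ^ 2 := by
  obtain ⟨u, hu, hS⟩ := hE.exists_flow_family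
  have hΓ : ∀ t ∈ Ioo (0 : ℝ) 1, γtilde t = u (γ t) (h t) := fun t ht => by
    rw [hγtilde t (Ioo_subset_Icc_self ht), hS _ _ (hpos t ht)]
  have hreg : ∀ a b : ℝ, 0 < a → a ≤ b → b < 1 →
      AbsolutelyContinuousOnInterval γtilde a b ∧
      AbsolutelyContinuousOnInterval (fun t => (E (γtilde t)).toReal) a b ∧
      ∀ t ∈ Icc a b, descendingSlope E (γtilde t) ≠ ⊤ := by
    intro a b ha hab hb
    have hIoo : ∀ t ∈ Icc a b, t ∈ Ioo (0 : ℝ) 1 := fun t ht =>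
      ⟨ha.trans_le ht.1, ht.2.trans_lt hb⟩
    have hsub : uIcc a b ⊆ uIcc (0 : ℝ) 1 := by
      rw [uIcc_of_le hab, uIcc_of_le zero_le_one]
      exact Icc_subset_Icc ha.le hb.le
    exact hE.regularized_curve hu hab (hγ.mono hsub) (hh.mono hsub)
      (fun t ht => hpos t (hIoo t ht)) fun t ht => hΓ t (hIoo t ht)
  have hslope : ∀ t ∈ Ioo (0 : ℝ) 1, descendingSlope E (γtilde t) ≠ ⊤ := fun t ht =>
    (hreg t t ht.1 le_rfl ht.2).2.2 t (left_mem_Icc.2 le_rfl)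
  refine ⟨fun t ht => ⟨?_, hslope t ht⟩, ?_⟩
  · rw [hΓ t ht]
    exact (hu (γ t)).flow.ne_top hE (hpos t ht)
  -- Since `h` may vanish at `0` and `1`, regularity holds only on compact subintervals; these
  -- countably many exhaust `(0, 1)`. The shift by `2` keeps the endpoints ordered at `n = 0`.
  have hn : ∀ n : ℕ, 0 < 1 / ((n : ℝ) + 2) ∧ 1 / ((n : ℝ) + 2) ≤ 1 - 1 / ((n : ℝ) + 2) ∧
      1 - 1 / ((n : ℝ) + 2) < 1 := by
    intro n
    have h0 : (0 : ℝ) ≤ n := n.cast_nonneg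
    have h1 : 0 < 1 / ((n : ℝ) + 2) := by positivity
    have h2 : 1 / ((n : ℝ) + 2) ≤ 1 / 2 := by gcongr; linarith
    exact ⟨h1, by linarith, by linarith⟩
  have hspeed : ∀ᵐ t : ℝ, ∀ n : ℕ, t ∈ Ioo (1 / ((n : ℝ) + 2)) (1 - 1 / ((n : ℝ) + 2)) →
      ∃ w, HasMetricSpeedAt γtilde w t := ae_all_iff.2 fun n =>
    (hreg _ _ (hn n).1 (hn n).2.1 (hn n).2.2).1.ae_hasMetricSpeedAt (hn n).2.1
  have hener : ∀ᵐ t : ℝ, ∀ n : ℕ, t ∈ uIcc (1 / ((n : ℝ) + 2)) (1 - 1 / ((n : ℝ) + 2)) →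
      DifferentiableAt ℝ (fun s => (E (γtilde s)).toReal) t := ae_all_iff.2 fun n =>
    (hreg _ _ (hn n).1 (hn n).2.1 (hn n).2.2).2.1.ae_differentiableAt
  filter_upwards [hγ.ae_hasMetricSpeedAt zero_le_one, hh.ae_differentiableAt, hspeed, hener]
    with t h1 h2 h3 h4 ht
  obtain ⟨v, hv⟩ := h1 ht
  obtain ⟨n, hnt⟩ : ∃ n : ℕ, t ∈ Ioo (1 / ((n : ℝ) + 2)) (1 - 1 / ((n : ℝ) + 2)) := by
    obtain ⟨n, hn'⟩ := exists_nat_one_div_lt (lt_min ht.1 (sub_pos.2 ht.2))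
    have h5 : 1 / ((n : ℝ) + 2) ≤ 1 / ((n : ℝ) + 1) := by gcongr; norm_num
    have h6 := lt_min_iff.1 hn'
    exact ⟨n, by linarith, by linarith⟩
  obtain ⟨w, hw⟩ := h3 n hnt
  have hde := (h4 n (by
    rw [uIcc_of_le (hn n).2.1]; exact Ioo_subset_Icc_self hnt)).hasDerivAt
  have hdh := (h2 (by rw [uIcc_of_le zero_le_one]; exact Ioo_subset_Icc_self ht)).hasDerivAt
  have hγc : ContinuousAt γ t := by
    have := hγ.continuousOn_of_metric
    rw [uIcc_of_le zero_le_one] at this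
    exact this.continuousAt (Icc_mem_nhds ht.1 ht.2)
  refine ⟨v, w, _, _, hv, hw, hdh, hde, ?_⟩
  refine hE.regularized_ineq hu hγc hv hw hdh hde (hpos t ht) ?_ (hslope t ht)
  filter_upwards [Ioo_mem_nhds ht.1 ht.2] with s hs using hΓ s hs
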